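/- Let $\mathbb K$ be a field of characteristic zero, let $G$ be an abelian group (written additively), and let $\varepsilon:G\times G\to\mathbb K^\times$ be an antisymmetric bicharacter, i.e. $\varepsilon(g,h)\varepsilon(h,g)=1$, $\varepsilon(g,h+k)=\varepsilon(g,h)\varepsilon(g,k)$ and $\varepsilon(g+h,k)=\varepsilon(g,k)\varepsilon(h,k)$. Let $L=\bigoplus_{g\in G}L_g$ be a $G$-graded $\varepsilon$-Lie algebra over $\mathbb K$, of arbitrary dimension: it has a bilinear bracket with $[L_g,L_h]\subseteq L_{g+h}$, $[a,b]=-\varepsilon(|a|,|b|)[b,a]$ and $$\varepsilon(|c|,|a|)[a,[b,c]]+\varepsilon(|a|,|b|)[b,[c,a]]+\varepsilon(|b|,|c|)[c,[a,b]]=0$$ for homogeneous $a,b,c$. Let $\omega:L\times L\to\mathbb K$ be a graded scalar $2$-cocycle of degree zero: a bilinear form such that, for homogeneous $x,y,z$, $\omega(x,y)=0$ if $|x|+|y|\neq 0$, $\omega(x,y)=-\varepsilon(|x|,|y|)\,\omega(y,x)$, and $$\varepsilon(|z|,|x|)\omega(x,[y,z])+\varepsilon(|x|,|y|)\omega(y,[z,x])+\varepsilon(|y|,|z|)\omega(z,[x,y])=0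 .$$ Let $T(L)$ be the tensor algebra of $L$, with its $\mathbb Z\times G$-grading in which $a_1\otimes\cdots\otimes a_n$ with $a_i\in L_{g_i}$ has degree $(n,g_1+\cdots+g_n)$. Let $U_\omega(L)$ be the quotient of $T(L)$ by the two-sided ideal generated by the elements $a\otimes b-\varepsilon(|a|,|b|)\,b\otimes a-[a,b]-\omega(a,b)$, and let $S(L)$ (the $\varepsilon$-symmetric algebra) be the quotient of $T(L)$ by the two-sided ideal generated by the elements $a\otimes b-\varepsilon(|a|,|b|)\,b\otimes a$, where $a,b$ run over the homogeneous elements of $L$. Give $S(L)$ the images of the $\mathbb Z\times G$-homogeneous components of $T(L)$, and $U_\omega(L)$ the images $U_\omega(L)_g$ of the $G$-homogeneous components of $T(L)$. For $n\in\mathbb Z$ let $U_{n,\omega}(L)$ be the image in $U_\omega(L)$ of the span of all tensors of order at most $n$ (so it is $0$ for $n<0$), let $$G_\omega(L)=\operatorname{gr}U_\omega(L)=\bigoplus_{n\in\mathbb Z}U_{n,\omega}(L)/U_{n-1,\omega}(L)$$ be the associated graded algebra, and let $G_\omega(L)_{(n,g)}$ be the image of $U_{n,\omega}(L)\cap U_\omega(L)_g$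 in $U_{n,\omega}(L)/U_{n-1,\omega}(L)$. Then $S(L)$ and $G_\omega(L)$ are $\mathbb Z\times G$-graded algebras for these components. There is exactly one algebra homomorphism $\varphi_\omega:S(L)\to G_\omega(L)$ which sends each $a\in L$ to the class in $U_{1,\omega}(L)/U_{0,\omega}(L)$ of the image of $a$ in $U_\omega(L)$, and $\varphi_\omega$ is an isomorphism of $\mathbb Z\times G$-graded algebras: it is bijective and $\varphi_\omega\bigl(S(L)_{(n,g)}\bigr)=G_\omega(L)_{(n,g)}$ for all $(n,g)\in\mathbb Z\times G$. -/

import Mathlib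

open scoped DirectSum

noncomputable section

/-! ### The associated graded algebra of a `ℤ`-filtered algebra -/

namespace FilteredAlg

variable {K A : Type*} [Field K] [Ring A] [Algebra K A]

/-- The degree `n` component `F n / F (n - 1)` of the associated graded algebra. -/
def Gr (F : ℤ → Submodule K A) (n : ℤ) : Type _ :=
  F n ⧸ (F (n - 1)).submoduleOf (F n)

instance (F : ℤ → Submodule K A) (n : ℤ) : AddCommGroup (Gr F n) :=
  inferInstanceAs (AddCommGroup (F n ⧸ (F (n - 1)).submoduleOf (F n)))

instance (F : ℤ → Submodule K A) (n : ℤ) : Module K (Gr F n) :=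
  inferInstanceAs (Module K (F n ⧸ (F (n - 1)).submoduleOf (F n)))

variable (F : ℤ → Submodule K A)

/-- The class in `F n / F (n - 1)` of an element of `F n`. -/
def symb (n : ℤ) : F n →ₗ[K] Gr F n := ((F (n - 1)).submoduleOf (F n)).mkQ

variable {F}

theorem symb_surjective (n : ℤ) : Function.Surjective (symb F n) :=
  Submodule.mkQ_surjective _

theorem symb_eq_symb_iff {n : ℤ} {x y : F n} :
    symb F n x = symb F n y ↔ (x : A) - y ∈ F (n - 1) := by
  exact Submodule.Quotient.eq ((F (n - 1)).submoduleOf (F n))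

theorem symb_mk_eq {n m : ℤ} (h : n = m) {x y : A} (hxy : x = y) (hx : x ∈ F n) (hy : y ∈ F m) :
    GradedMonoid.mk (A := Gr F) n (symb F n ⟨x, hx⟩) = GradedMonoid.mk m (symb F m ⟨y, hy⟩) := by
  subst h
  subst hxy
  rfl

variable (F)
variable [IsRingFiltration F (fun n => F (n - 1))]

theorem mul_mem {i j : ℤ} {x y : A} (hx : x ∈ F i) (hy : y ∈ F j) : x * y ∈ F (i + j) :=
  SetLike.mul_mem_graded hx hy

theorem one_mem : (1 : A) ∈ F 0 := SetLike.one_mem_graded F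

/-- The product `F i / F (i - 1) × F j / F (j - 1) → F (i + j) / F (i + j - 1)` induced by the
product of `A`. -/
def grMul (i j : ℤ) : Gr F i → Gr F j → Gr F (i + j) :=
  Quotient.map₂ (fun x y => ⟨(x : A) * y, mul_mem F x.2 y.2⟩) (by
    intro x x' hx y y' hy
    rw [← Quotient.eq_iff_equiv] at hx hy ⊢
    have hx' : (x : A) - x' ∈ F (i - 1) := symb_eq_symb_iff.1 hx
    have hy' : (y : A) - y' ∈ F (j - 1) := symb_eq_symb_iff.1 hy
    refine symb_eq_symb_iff.2 ?_
    have h1 := mul_mem F hx' y.2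
    have h2 := mul_mem F x'.2 hy'
    rw [show i - 1 + j = i + j - 1 by ring] at h1
    rw [show i + (j - 1) = i + j - 1 by ring] at h2
    have h3 := (F (i + j - 1)).add_mem h1 h2
    rw [sub_mul, mul_sub] at h3
    simpa using h3)

variable {F}

instance instGMul : GradedMonoid.GMul (Gr F) where
  mul {i j} a b := grMul F i j a b

theorem grMul_symb {i j : ℤ} (x : F i) (y : F j) :
    GradedMonoid.GMul.mul (symb F i x) (symb F j y) =
      symb F (i + j) ⟨(x : A) * y, mul_mem F x.2 y.2⟩ := rfl

instance instGOne : GradedMonoid.GOne (Gr F) where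
  one := symb F 0 ⟨1, one_mem F⟩

instance instGRing : DirectSum.GRing (Gr F) where
  mul_zero {i j} a := by
    obtain ⟨x, rfl⟩ := symb_surjective i a
    rw [← map_zero (symb F j), grMul_symb, ← map_zero (symb F (i + j))]
    congr 1
    ext
    simp
  zero_mul {i j} a := by
    obtain ⟨x, rfl⟩ := symb_surjective j a
    rw [← map_zero (symb F i), grMul_symb, ← map_zero (symb F (i + j))]
    congr 1
    ext
    simp
  mul_add {i j} a b c := by
    obtain ⟨x, rfl⟩ := symb_surjective i a
    obtain ⟨y, rfl⟩ := symb_surjective j b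
    obtain ⟨z, rfl⟩ := symb_surjective j c
    rw [← map_add (symb F j), grMul_symb, grMul_symb, grMul_symb, ← map_add (symb F (i + j))]
    congr 1
    ext
    simp [mul_add]
  add_mul {i j} a b c := by
    obtain ⟨x, rfl⟩ := symb_surjective i a
    obtain ⟨y, rfl⟩ := symb_surjective i b
    obtain ⟨z, rfl⟩ := symb_surjective j c
    rw [← map_add (symb F i), grMul_symb, grMul_symb, grMul_symb, ← map_add (symb F (i + j))]
    congr 1
    ext
    simp [add_mul]
  one_mul := by
    rintro ⟨i, a⟩
    obtain ⟨x, rfl⟩ := symb_surjective i a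
    exact symb_mk_eq (zero_add i) (one_mul (x : A)) _ x.2
  mul_one := by
    rintro ⟨i, a⟩
    obtain ⟨x, rfl⟩ := symb_surjective i a
    exact symb_mk_eq (add_zero i) (mul_one (x : A)) _ x.2
  mul_assoc := by
    rintro ⟨i, a⟩ ⟨j, b⟩ ⟨k, c⟩
    obtain ⟨x, rfl⟩ := symb_surjective i a
    obtain ⟨y, rfl⟩ := symb_surjective j b
    obtain ⟨z, rfl⟩ := symb_surjective k c
    exact symb_mk_eq (add_assoc i j k) (mul_assoc (x : A) y z) _ _
  natCast n := n • symb F 0 ⟨1, one_mem F⟩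
  natCast_zero := zero_smul _ _
  natCast_succ n := succ_nsmul _ n
  intCast n := n • symb F 0 ⟨1, one_mem F⟩
  intCast_ofNat n := natCast_zsmul _ n
  intCast_negSucc_ofNat n := negSucc_zsmul _ n

instance instGAlgebra : DirectSum.GAlgebra K (Gr F) where
  toFun := ((LinearMap.toSpanSingleton K (Gr F 0) (symb F 0 ⟨1, one_mem F⟩)).toAddMonoidHom)
  map_one := one_smul K (symb F 0 ⟨1, one_mem F⟩)
  map_mul r s := by
    refine symb_mk_eq (zero_add 0).symm (x := (r * s) • (1 : A)) (y := (r • 1) * (s • 1)) ?_ _ _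
    rw [smul_mul_smul_comm, one_mul]
  commutes := by
    rintro r ⟨i, a⟩
    obtain ⟨x, rfl⟩ := symb_surjective i a
    refine symb_mk_eq ((zero_add i).trans (add_zero i).symm)
      (x := (r • (1 : A)) * x) (y := x * (r • (1 : A))) ?_ _ _
    rw [smul_mul_assoc, mul_smul_comm, one_mul, mul_one]
  smul_def := by
    rintro r ⟨i, a⟩
    obtain ⟨x, rfl⟩ := symb_surjective i a
    refine symb_mk_eq (zero_add i).symm (x := r • (x : A)) (y := (r • (1 : A)) * x) ?_ _ _
    rw [smul_mul_assoc, one_mul]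

end FilteredAlg

/-! ### Color Lie algebras, scalar cocycles and generalized enveloping algebras -/

namespace ColorLie


variable {K G L : Type*} [Field K] [AddCommGroup G] [AddCommGroup L] [Module K L]

/-- `ε` is an antisymmetric bicharacter of the abelian group `G` (written additively). -/
structure IsAntisymmBicharacter (ε : G → G → Kˣ) : Prop where
  mul_swap : ∀ g h, ε g h * ε h g = 1
  add_right : ∀ g h k, ε g (h + k) = ε g h * ε g k
  add_left : ∀ g h k, ε (g + h) k = ε g k * ε h k

/-- `L`, with the homogeneous components `𝓛 g` and the bracket `br`, is a `G`-graded
`ε`-Lie algebra (color Lie algebra). -/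
structure IsColorLieAlgebra [DecidableEq G] (ε : G → G → Kˣ) (𝓛 : G → Submodule K L)
    (br : L →ₗ[K] L →ₗ[K] L) : Prop where
  isInternal : DirectSum.IsInternal 𝓛
  bracket_mem : ∀ {g h : G} {a b : L}, a ∈ 𝓛 g → b ∈ 𝓛 h → br a b ∈ 𝓛 (g + h)
  skew : ∀ {g h : G} {a b : L}, a ∈ 𝓛 g → b ∈ 𝓛 h → br a b = -((ε g h : K) • br b a)
  jacobi : ∀ {g h k : G} {a b c : L}, a ∈ 𝓛 g → b ∈ 𝓛 h → c ∈ 𝓛 k →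
    (ε k g : K) • br a (br b c) + (ε g h : K) • br b (br c a) + (ε h k : K) • br c (br a b) = 0

/-- `ω` is a graded scalar 2-cocycle: an `ε`-skew-symmetric bilinear form of degree zero
(`K` being concentrated in degree zero) which satisfies the cocycle identity for the trivial
module `K`. -/
structure IsScalarTwoCocycle (ε : G → G → Kˣ) (𝓛 : G → Submodule K L)
    (br : L →ₗ[K] L →ₗ[K] L) (ω : L →ₗ[K] L →ₗ[K] K) : Prop where
  degree_zero : ∀ {g h : G} {x y : L}, x ∈ 𝓛 g → y ∈ 𝓛 h → g + h ≠ 0 → ω x y = 0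
  skew : ∀ {g h : G} {x y : L}, x ∈ 𝓛 g → y ∈ 𝓛 h → ω x y = -((ε g h : K) * ω y x)
  cocycle : ∀ {g h k : G} {x y z : L}, x ∈ 𝓛 g → y ∈ 𝓛 h → z ∈ 𝓛 k →
    (ε k g : K) * ω x (br y z) + (ε g h : K) * ω y (br z x) + (ε h k : K) * ω z (br x y) = 0

/-- The generators of the ideal which defines the generalized enveloping algebra:
`a ⊗ b - ε(|a|, |b|) b ⊗ a - [a, b] - ω(a, b)`, for homogeneous `a`, `b`, are set to zero. -/
inductive EnvRel (ε : G → G → Kˣ) (𝓛 : G → Submodule K L) (br : L →ₗ[K] L →ₗ[K] L)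
    (ω : L →ₗ[K] L →ₗ[K] K) : TensorAlgebra K L → TensorAlgebra K L → Prop
  | rel {g h : G} {a b : L} (ha : a ∈ 𝓛 g) (hb : b ∈ 𝓛 h) :
      EnvRel ε 𝓛 br ω
        (TensorAlgebra.ι K a * TensorAlgebra.ι K b
          - (ε g h : K) • (TensorAlgebra.ι K b * TensorAlgebra.ι K a)
          - TensorAlgebra.ι K (br a b) - algebraMap K (TensorAlgebra K L) (ω a b)) 0

/-- The generalized enveloping algebra `U_ω(L)`: the quotient of the tensor algebra `T(L)` by the
two-sided ideal generated by the elements above. -/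
def GenEnv (ε : G → G → Kˣ) (𝓛 : G → Submodule K L) (br : L →ₗ[K] L →ₗ[K] L)
    (ω : L →ₗ[K] L →ₗ[K] K) : Type _ :=
  RingQuot (EnvRel ε 𝓛 br ω)

instance (ε : G → G → Kˣ) (𝓛 : G → Submodule K L) (br : L →ₗ[K] L →ₗ[K] L)
    (ω : L →ₗ[K] L →ₗ[K] K) : Ring (GenEnv ε 𝓛 br ω) :=
  inferInstanceAs (Ring (RingQuot (EnvRel ε 𝓛 br ω)))

instance (ε : G → G → Kˣ) (𝓛 : G → Submodule K L) (br : L →ₗ[K] L →ₗ[K] L)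
    (ω : L →ₗ[K] L →ₗ[K] K) : Algebra K (GenEnv ε 𝓛 br ω) :=
  inferInstanceAs (Algebra K (RingQuot (EnvRel ε 𝓛 br ω)))

/-- The `ε`-symmetric algebra `S(L)` of a graded space: the quotient of `T(L)` by the two-sided
ideal generated by the elements `a ⊗ b - ε(|a|, |b|) b ⊗ a`, i.e. the case of zero bracket and
zero cocycle. -/
abbrev SymAlg (ε : G → G → Kˣ) (𝓛 : G → Submodule K L) : Type _ :=
  GenEnv ε 𝓛 0 0

/-- The component of degree `(n, g)` of the `ℤ × G`-graded algebra `T(L)`: the span of the tensors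
`a₁ ⊗ ⋯ ⊗ aₙ` with `aᵢ` homogeneous of degree `dᵢ` and `d₁ + ⋯ + dₙ = g`
(it is zero for negative `n`). -/
def tensorGrading (𝓛 : G → Submodule K L) (p : ℤ × G) : Submodule K (TensorAlgebra K L) :=
  Submodule.span K {t | ∃ (n : ℕ) (a : Fin n → L) (d : Fin n → G),
    (∀ i, a i ∈ 𝓛 (d i)) ∧ ((n : ℤ), ∑ i, d i) = p ∧ t = TensorAlgebra.tprod K L n a}

/-- The subspace `T_n(L)` of `T(L)` spanned by the tensors of order at most `n`
(it is zero for negative `n`). -/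
def tensorFiltration (K L : Type*) [Field K] [AddCommGroup L] [Module K L] (n : ℤ) :
    Submodule K (TensorAlgebra K L) :=
  ⨆ (m : ℕ) (_ : (m : ℤ) ≤ n), LinearMap.range (TensorAlgebra.ι K (M := L)) ^ m

theorem pow_le_tensorFiltration {m : ℕ} {n : ℤ} (h : (m : ℤ) ≤ n) :
    LinearMap.range (TensorAlgebra.ι K (M := L)) ^ m ≤ tensorFiltration K L n :=
  le_iSup₂_of_le m h le_rfl

theorem tensorFiltration_mul_le (i j : ℤ) :
    tensorFiltration K L i * tensorFiltration K L j ≤ tensorFiltration K L (i + j) := by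
  unfold tensorFiltration
  simp only [Submodule.iSup_mul, Submodule.mul_iSup]
  refine iSup₂_le fun m hm => iSup₂_le fun k hk => ?_
  rw [← pow_add]
  exact pow_le_tensorFiltration (by push_cast; omega)

section

variable (ε : G → G → Kˣ) (𝓛 : G → Submodule K L) (br : L →ₗ[K] L →ₗ[K] L)
  (ω : L →ₗ[K] L →ₗ[K] K)

/-- The quotient map `T(L) → U_ω(L)`. -/
def envMk : TensorAlgebra K L →ₐ[K] GenEnv ε 𝓛 br ω := RingQuot.mkAlgHom K (EnvRel ε 𝓛 br ω)

/-- The canonical map `i_ω : L → U_ω(L)`. -/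
def envι : L →ₗ[K] GenEnv ε 𝓛 br ω := (envMk ε 𝓛 br ω).toLinearMap ∘ₗ TensorAlgebra.ι K

theorem envι_rel {g h : G} {a b : L} (ha : a ∈ 𝓛 g) (hb : b ∈ 𝓛 h) :
    envι ε 𝓛 br ω a * envι ε 𝓛 br ω b - (ε g h : K) • (envι ε 𝓛 br ω b * envι ε 𝓛 br ω a) =
      envι ε 𝓛 br ω (br a b) + algebraMap K _ (ω a b) := by
  have h0 : envMk ε 𝓛 br ω _ = envMk ε 𝓛 br ω _ :=
    RingQuot.mkAlgHom_rel K (EnvRel.rel (ε := ε) (br := br) (ω := ω) ha hb)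
  simp only [map_sub, map_mul, map_smul, AlgHom.commutes, map_zero] at h0
  rw [sub_sub, sub_eq_zero] at h0
  exact h0

/-- The filtration of `U_ω(L)`: `U_{n,ω}(L)` is the canonical image of `T_n(L)`, that is, the span
of the products of at most `n` elements of `L`; it is zero for negative `n`. -/
def envFiltration (n : ℤ) : Submodule K (GenEnv ε 𝓛 br ω) :=
  (tensorFiltration K L n).map (envMk ε 𝓛 br ω).toLinearMap

/-- The `G`-grading of `U_ω(L)`: the canonical image of the `G`-grading of `T(L)`. -/
def envGrading (g : G) : Submodule K (GenEnv ε 𝓛 br ω) :=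
  (⨆ n : ℤ, tensorGrading 𝓛 (n, g)).map (envMk ε 𝓛 br ω).toLinearMap

instance envFiltration_isRingFiltration :
    IsRingFiltration (envFiltration ε 𝓛 br ω) (fun n => envFiltration ε 𝓛 br ω (n - 1)) := by
  have : SetLike.GradedMonoid (envFiltration ε 𝓛 br ω) :=
    { one_mem := by
        refine ⟨1, ?_, map_one (envMk ε 𝓛 br ω)⟩
        refine pow_le_tensorFiltration (m := 0) le_rfl ?_
        rw [pow_zero]
        exact Submodule.one_le.1 le_rfl
      mul_mem := by
        rintro i j _ _ ⟨x, hx, rfl⟩ ⟨y, hy, rfl⟩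
        exact ⟨x * y, tensorFiltration_mul_le i j (Submodule.mul_mem_mul hx hy),
          map_mul (envMk ε 𝓛 br ω) x y⟩ }
  refine IsRingFiltration.mk_int _ fun i j hij => Submodule.map_mono ?_
  exact iSup₂_le fun m hm => pow_le_tensorFiltration (hm.trans hij)

/-- `G_ω(L)`, the algebra `⨁ₙ U_{n,ω}(L) / U_{n-1,ω}(L)` associated with the filtered algebra
`U_ω(L)`. -/
abbrev GrEnv : Type _ := ⨁ n : ℤ, FilteredAlg.Gr (envFiltration ε 𝓛 br ω) n

/-- The component of degree `(n, g)` of `G_ω(L)`: the classes in `U_{n,ω}(L) / U_{n-1,ω}(L)` of the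
elements of `U_{n,ω}(L)` which are homogeneous of degree `g`. -/
def grGrading (p : ℤ × G) : Submodule K (GrEnv ε 𝓛 br ω) :=
  (((envGrading ε 𝓛 br ω p.2).submoduleOf (envFiltration ε 𝓛 br ω p.1)).map
    (FilteredAlg.symb (envFiltration ε 𝓛 br ω) p.1)).map
      (DirectSum.lof K ℤ (FilteredAlg.Gr (envFiltration ε 𝓛 br ω)) p.1)

/-- The `ℤ × G`-grading of `S(L)`, the canonical image of that of `T(L)`. -/
def symGrading (p : ℤ × G) : Submodule K (SymAlg ε 𝓛) :=
  (tensorGrading 𝓛 p).map (envMk ε 𝓛 0 0).toLinearMap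

theorem envι_mem (a : L) : envι ε 𝓛 br ω a ∈ envFiltration ε 𝓛 br ω 1 :=
  ⟨TensorAlgebra.ι K a, pow_le_tensorFiltration (m := 1) le_rfl
    (by rw [pow_one]; exact LinearMap.mem_range_self _ a), rfl⟩

/-- The canonical map `L → U_ω(L) → G_ω(L)`, which sends `a` to the class of `i_ω(a)` in
`U_{1,ω}(L) / U_{0,ω}(L)`. -/
def grι : L →ₗ[K] GrEnv ε 𝓛 br ω :=
  DirectSum.lof K ℤ (FilteredAlg.Gr (envFiltration ε 𝓛 br ω)) 1 ∘ₗ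
    FilteredAlg.symb (envFiltration ε 𝓛 br ω) 1 ∘ₗ
      (envι ε 𝓛 br ω).codRestrict (envFiltration ε 𝓛 br ω 1) (envι_mem ε 𝓛 br ω)

theorem grι_mul_grι (a b : L) :
    grι ε 𝓛 br ω a * grι ε 𝓛 br ω b =
      DirectSum.lof K ℤ (FilteredAlg.Gr (envFiltration ε 𝓛 br ω)) (1 + 1)
        (FilteredAlg.symb (envFiltration ε 𝓛 br ω) (1 + 1)
          ⟨envι ε 𝓛 br ω a * envι ε 𝓛 br ω b, FilteredAlg.mul_mem (envFiltration ε 𝓛 br ω)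
            (envι_mem ε 𝓛 br ω a) (envι_mem ε 𝓛 br ω b)⟩) :=
  DirectSum.of_mul_of _ _

/-- The images of homogeneous elements of `L` in `G_ω(L)` `ε`-commute. -/
theorem grι_comm {g h : G} {a b : L} (ha : a ∈ 𝓛 g) (hb : b ∈ 𝓛 h) :
    grι ε 𝓛 br ω a * grι ε 𝓛 br ω b - (ε g h : K) • (grι ε 𝓛 br ω b * grι ε 𝓛 br ω a) = 0 := by
  rw [grι_mul_grι, grι_mul_grι, ← map_smul, ← map_smul, sub_eq_zero]
  congr 1
  rw [FilteredAlg.symb_eq_symb_iff]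
  change envι ε 𝓛 br ω a * envι ε 𝓛 br ω b
    - (ε g h : K) • (envι ε 𝓛 br ω b * envι ε 𝓛 br ω a) ∈ envFiltration ε 𝓛 br ω (1 + 1 - 1)
  rw [envι_rel ε 𝓛 br ω ha hb, show (1 + 1 - 1 : ℤ) = 1 by norm_num, Algebra.algebraMap_eq_smul_one]
  refine Submodule.add_mem _ (envι_mem ε 𝓛 br ω _) (Submodule.smul_mem _ _ ?_)
  exact IsFiltration.mono (F := envFiltration ε 𝓛 br ω) zero_le_one
    (FilteredAlg.one_mem (envFiltration ε 𝓛 br ω))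

/-- The canonical homomorphism `φ_ω : S(L) → G_ω(L)`, the algebra homomorphism which extends
`L → G_ω(L)`. -/
def canonicalHom : SymAlg ε 𝓛 →ₐ[K] GrEnv ε 𝓛 br ω :=
  RingQuot.liftAlgHom K ⟨TensorAlgebra.lift K (grι ε 𝓛 br ω), by
    rintro _ _ ⟨ha, hb⟩
    simpa using grι_comm ε 𝓛 br ω ha hb⟩

/-- `φ_ω` extends the map `L → G_ω(L)`. -/
theorem canonicalHom_ι (a : L) :
    canonicalHom ε 𝓛 br ω (envι ε 𝓛 0 0 a) = grι ε 𝓛 br ω a := by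
  have h := RingQuot.liftAlgHom_mkAlgHom_apply K (TensorAlgebra.lift K (grι ε 𝓛 br ω))
    (s := EnvRel ε 𝓛 0 0) (by
      rintro _ _ ⟨ha, hb⟩
      simpa using grι_comm ε 𝓛 br ω ha hb) (TensorAlgebra.ι K a)
  rw [TensorAlgebra.lift_ι_apply] at h
  exact h

end

end ColorLie

end

/-!
Order a basis of homogeneous elements of `L`. The relations of `U_ω(L)` rewrite `x y` as
`ε(|x|, |y|) y x + [x, y] + ω(x, y)` if `y < x`, and `x x` as `([x, x] + ω(x, x)) / 2` if
`ε(|x|, |x|) = -1`, that is, if `x` is odd. Rewriting each word at one chosen place gives a linear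
map `T(L) → S(L)` which fixes the leading terms, and the point is that it vanishes on the whole
ideal of relations. Its defects, the failures to respect the rule at other places, are related by
the skew-symmetry of the rule, by commutation for disjoint places and, for overlapping ones, by a
braid relation which encodes the Jacobi and cocycle identities. By induction on the length and the
number of inversions, the vanishing of the defect at one place of a word propagates to all the
others; repeated odd letters cost a division by `2` or `3` here.

The resulting map `U_ω(L) → S(L)`, followed on `U_{n,ω}(L)` by the projection of `S(L)` to
degree `n`, induces a left inverse of `φ_ω`.
-/

noncomputable section

namespace ColorLie

/-! ### Confluence of the straightening rule -/

section Confluence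

variable {X K V : Type*} [LinearOrder X]

/-- The number of inversions of a word. -/
def inversions : List X → ℕ
  | [] => 0
  | x :: w => w.countP (· < x) + inversions w

theorem inversions_swap_lt (u v : List X) {x y : X} (h : y < x) :
    inversions (u ++ y :: x :: v) < inversions (u ++ x :: y :: v) := by
  induction u with
  | nil =>
    simp only [List.nil_append, inversions, List.countP_cons, decide_eq_true_eq, h, if_true,
      not_lt.2 h.le, if_false]
    omega
  | cons z u ih =>
    have hcount : (u ++ y :: x :: v).countP (· < z) = (u ++ x :: y :: v).countP (· < z) :=
      ((List.Perm.swap x y v).append_left u).countP_eq _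
    simp only [List.cons_append, inversions]
    omega

variable [Field K]

/-- The two-letter words `x y` to be rewritten: inversions and repeated odd letters. The scalar
`e x y` stands for `ε(|x|, |y|)`. -/
def IsRedex (e : X → X → K) (x y : X) : Prop := y < x ∨ x = y ∧ e x x = -1

/-- A place of the word `w` where it can be rewritten. -/
structure RedexOccurrence (e : X → X → K) (w : List X) where
  left : List X
  fst : X
  snd : X
  right : List X
  eq_append : w = left ++ fst :: snd :: right
  isRedex : IsRedex e fst snd

variable {e : X → X → K}

theorem isRedex_or_swap_or_even (he : ∀ x y, e x y * e y x = 1) (x y : X) :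
    IsRedex e x y ∨ IsRedex e y x ∨ x = y ∧ e x x = 1 := by
  rcases lt_trichotomy x y with h | rfl | h
  · exact .inr (.inl (.inl h))
  · rcases mul_self_eq_one_iff.1 (he x x) with h | h
    · exact .inr (.inr ⟨rfl, h⟩)
    · exact .inl (.inr ⟨rfl, h⟩)
  · exact .inl (.inl h)

variable [AddCommGroup V] [Module K V]

theorem IsRedex.exists_smul_swap (h2 : (2 : K) ≠ 0) {x y : X} (h : IsRedex e x y) {f : X → X → V}
    (hf : y < x → f y x = 0) : ∃ k : K, k ≠ 0 ∧ e x y • f y x = (1 - k) • f x y := by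
  rcases h with h | ⟨rfl, h⟩
  · exact ⟨1, one_ne_zero, by rw [hf h, smul_zero, sub_self, zero_smul]⟩
  · exact ⟨2, h2, by rw [h]; norm_num⟩

/-- The relations satisfied by the failures `p u x y v` of a linear functional on words of length
`n` to respect the rule which rewrites `x y` between `u` and `v`. They come from the skew-symmetry
of the rule, from the commutation of rewritings at disjoint places, and from the braid relation
for overlapping ones. -/
structure IsDefect (e : X → X → K) (n : ℕ) (p : List X → X → X → List X → V) : Prop where
  skew : ∀ u x y v, (u ++ x :: y :: v).length = n → p u x y v + e x y • p u y x v = 0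
  comm : ∀ u x y m z t v, (u ++ x :: y :: (m ++ z :: t :: v)).length = n →
    p u x y (m ++ z :: t :: v) + e x y • p (u ++ y :: x :: m) z t v =
      p (u ++ x :: y :: m) z t v + e z t • p u x y (m ++ t :: z :: v)
  braid : ∀ u x y z v, (u ++ x :: y :: z :: v).length = n →
    p u x y (z :: v) + e x y • p (u ++ [y]) x z v + (e x y * e x z) • p u y z (x :: v) =
      p (u ++ [x]) y z v + e y z • p u x z (y :: v) + (e y z * e x z) • p (u ++ [z]) x y v

namespace IsDefect

variable {n N : ℕ} {p : List X → X → X → List X → V}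

theorem eq_zero_iff_of_disjoint (hp : IsDefect e n p) (h2 : (2 : K) ≠ 0)
    (ih : ∀ w, w.length = n → inversions w < N →
      ∀ r : RedexOccurrence e w, p r.left r.fst r.snd r.right = 0)
    {u m v : List X} {x y z t : X} (hn : (u ++ x :: y :: (m ++ z :: t :: v)).length = n)
    (hN : inversions (u ++ x :: y :: (m ++ z :: t :: v)) = N)
    (hxy : IsRedex e x y) (hzt : IsRedex e z t) :
    p u x y (m ++ z :: t :: v) = 0 ↔ p (u ++ x :: y :: m) z t v = 0 := by
  obtain ⟨k, hk, hxy'⟩ := hxy.exists_smul_swap h2 (f := fun a b => p (u ++ a :: b :: m) z t v)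
    fun hlt => ih _ (by simpa using hn) (hN ▸ inversions_swap_lt u _ hlt)
      ⟨_, z, t, v, by simp, hzt⟩
  obtain ⟨l, hl, hzt'⟩ := hzt.exists_smul_swap h2 (f := fun a b => p u x y (m ++ a :: b :: v))
    fun hlt => ih _ (by simpa using hn)
      (by simpa [← hN] using inversions_swap_lt (u ++ x :: y :: m) v hlt) ⟨u, x, y, _, rfl, hxy⟩
  have hcomm : l • p u x y (m ++ z :: t :: v) = k • p (u ++ x :: y :: m) z t v := by
    linear_combination (norm := module) hp.comm u x y m z t v hn - hxy' + hzt'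
  rw [← smul_eq_zero_iff_right hl, hcomm, smul_eq_zero_iff_right hk]

theorem eq_zero_iff_of_overlap (hp : IsDefect e n p) (h2 : (2 : K) ≠ 0) (h3 : (3 : K) ≠ 0)
    (ih : ∀ w, w.length = n → inversions w < N →
      ∀ r : RedexOccurrence e w, p r.left r.fst r.snd r.right = 0)
    {u v : List X} {x y z : X} (hn : (u ++ x :: y :: z :: v).length = n)
    (hN : inversions (u ++ x :: y :: z :: v) = N) (hxy : IsRedex e x y) (hyz : IsRedex e y z) :
    p u x y (z :: v) = 0 ↔ p (u ++ [x]) y z v = 0 := by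
  have hbraid := hp.braid u x y z v hn
  have swap_fst (h : y < x) : inversions (u ++ y :: x :: z :: v) < N :=
    hN ▸ inversions_swap_lt u (z :: v) h
  have swap_snd (h : z < y) : inversions (u ++ x :: z :: y :: v) < N := by
    simpa [← hN] using inversions_swap_lt (u ++ [x]) v h
  have move_fst (h : y < x) (h' : z < x) : inversions (u ++ y :: z :: x :: v) < N := by
    simpa using (inversions_swap_lt (u ++ [y]) v h').trans (by simpa using swap_fst h)
  have move_snd (h : z < y) (h' : z < x) : inversions (u ++ z :: x :: y :: v) < N :=
    (inversions_swap_lt u (y :: v) h').trans (swap_snd h)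
  have yxz (h : y < x) (hxz : IsRedex e x z) : p (u ++ [y]) x z v = 0 :=
    ih _ (by simpa using hn) (swap_fst h) ⟨_, x, z, v, by simp, hxz⟩
  have xzy (h : z < y) (hxz : IsRedex e x z) : p u x z (y :: v) = 0 :=
    ih _ (by simpa using hn) (swap_snd h) ⟨u, x, z, _, rfl, hxz⟩
  have yzx (h : y < x) (h' : z < x) : p u y z (x :: v) = 0 :=
    ih _ (by simpa using hn) (move_fst h h') ⟨u, y, z, _, rfl, hyz⟩
  have zxy (h : z < y) (h' : z < x) : p (u ++ [z]) x y v = 0 :=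
    ih _ (by simpa using hn) (move_snd h h') ⟨_, x, y, v, by simp, hxy⟩
  rcases id hxy with hyx | ⟨rfl, hodd⟩ <;> rcases id hyz with hzy | ⟨rfl, hodd'⟩
  · have hzx := hzy.trans hyx
    rw [yxz hyx (.inl hzx), xzy hzy (.inl hzx), yzx hyx hzx, zxy hzy hzx] at hbraid
    rw [show p u x y (z :: v) = p (u ++ [x]) y z v by simpa using hbraid]
  · rw [yxz hyx hxy, yzx hyx hyx, hodd'] at hbraid
    have htwo : (2 : K) • p u x y (y :: v) = p (u ++ [x]) y y v := by
      linear_combination (norm := module) hbraid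
    rw [← htwo, smul_eq_zero_iff_right h2]
  · rw [xzy hzy hyz, zxy hzy hzy, hodd] at hbraid
    have htwo : p u x x (z :: v) = (2 : K) • p (u ++ [x]) x z v := by
      linear_combination (norm := module) hbraid
    rw [htwo, smul_eq_zero_iff_right h2]
  · rw [hodd] at hbraid
    have hthree : (3 : K) • p u x x (x :: v) = (3 : K) • p (u ++ [x]) x x v := by
      linear_combination (norm := module) hbraid
    rw [smul_right_injective V h3 hthree]

theorem eq_zero_iff_of_length_le (hp : IsDefect e n p) (h2 : (2 : K) ≠ 0) (h3 : (3 : K) ≠ 0)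
    (ih : ∀ w, w.length = n → inversions w < N →
      ∀ r : RedexOccurrence e w, p r.left r.fst r.snd r.right = 0)
    {w : List X} (hn : w.length = n) (hN : inversions w = N) (r s : RedexOccurrence e w)
    (hrs : r.left.length ≤ s.left.length) :
    p r.left r.fst r.snd r.right = 0 ↔ p s.left s.fst s.snd s.right = 0 := by
  obtain ⟨u, x, y, v, rfl, hxy⟩ := r
  obtain ⟨u', x', y', v', heq, hxy'⟩ := s
  obtain ⟨m, rfl⟩ : u <+: u' :=
    List.prefix_of_prefix_length_le ⟨_, rfl⟩ ⟨_, heq.symm⟩ hrs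
  rw [List.append_assoc, List.append_cancel_left_eq] at heq
  match m, heq with
  | [], heq =>
    simp only [List.nil_append, List.cons.injEq] at heq
    obtain ⟨rfl, rfl, rfl⟩ := heq
    simp only [List.append_nil]
  | [_], heq =>
    simp only [List.cons_append, List.nil_append, List.cons.injEq] at heq
    obtain ⟨rfl, rfl, rfl⟩ := heq
    exact hp.eq_zero_iff_of_overlap h2 h3 ih hn hN hxy hxy'
  | _ :: _ :: m, heq =>
    simp only [List.cons_append, List.cons.injEq] at heq
    obtain ⟨rfl, rfl, rfl⟩ := heq
    exact hp.eq_zero_iff_of_disjoint h2 ih hn hN hxy hxy'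

theorem eq_zero_of_redexOccurrence (hp : IsDefect e n p) (h2 : (2 : K) ≠ 0) (h3 : (3 : K) ≠ 0)
    (red : ∀ w, w.length = n → Nonempty (RedexOccurrence e w) →
      ∃ r : RedexOccurrence e w, p r.left r.fst r.snd r.right = 0)
    (w : List X) (hn : w.length = n) (r : RedexOccurrence e w) :
    p r.left r.fst r.snd r.right = 0 := by
  induction hN : inversions w using Nat.strong_induction_on generalizing w with
  | _ N ih =>
    have ih' (w') (hw' : w'.length = n) (hlt : inversions w' < N) (r : RedexOccurrence e w') :
        p r.left r.fst r.snd r.right = 0 := ih _ hlt w' hw' r rfl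
    obtain ⟨s, hs⟩ := red w hn ⟨r⟩
    rcases le_total r.left.length s.left.length with hrs | hsr
    · exact (hp.eq_zero_iff_of_length_le h2 h3 ih' hn hN r s hrs).2 hs
    · exact (hp.eq_zero_iff_of_length_le h2 h3 ih' hn hN s r hsr).1 hs

theorem eq_zero (hp : IsDefect e n p) (h2 : (2 : K) ≠ 0) (h3 : (3 : K) ≠ 0)
    (he : ∀ x y, e x y * e y x = 1)
    (red : ∀ w, w.length = n → Nonempty (RedexOccurrence e w) →
      ∃ r : RedexOccurrence e w, p r.left r.fst r.snd r.right = 0)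
    {u v : List X} {x y : X} (hn : (u ++ x :: y :: v).length = n) : p u x y v = 0 := by
  have hredex {x y : X} (hn : (u ++ x :: y :: v).length = n) (h : IsRedex e x y) :
      p u x y v = 0 := hp.eq_zero_of_redexOccurrence h2 h3 red _ hn ⟨u, x, y, v, rfl, h⟩
  rcases isRedex_or_swap_or_even he x y with h | h | ⟨rfl, heven⟩
  · exact hredex hn h
  · simpa [hredex (by simpa using hn) h] using hp.skew u x y v hn
  · have htwo : (2 : K) • p u x x v = 0 := by
      simpa [heven, two_smul] using hp.skew u x x v hn
    exact (smul_eq_zero_iff_right h2).1 htwo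

end IsDefect

end Confluence

/-! ### Words and relators -/

section Words

variable {X K L V : Type*} [Field K] [AddCommGroup L] [Module K L] [AddCommGroup V] [Module K V]
variable (b : Module.Basis X K L)

/-- The product in `T(L)` of the basis elements named by the letters of a word. -/
def word (w : List X) : TensorAlgebra K L := (w.map fun x => TensorAlgebra.ι K (b x)).prod

@[simp] theorem word_nil : word b [] = 1 := rfl

@[simp] theorem word_cons (x : X) (w : List X) :
    word b (x :: w) = TensorAlgebra.ι K (b x) * word b w := List.prod_cons

@[simp] theorem word_append (u v : List X) : word b (u ++ v) = word b u * word b v := by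
  simp [word]

theorem tensorAlgebra_basis_apply (w : FreeMonoid X) :
    b.tensorAlgebra w = word b w.toList := by
  induction w using FreeMonoid.recOn with
  | one => simp [Module.Basis.tensorAlgebra, FreeAlgebra.basisFreeMonoid,
      FreeAlgebra.equivMonoidAlgebraFreeMonoid]
  | of_mul x w ih =>
    rw [FreeMonoid.toList_of_mul, word_cons, ← ih]
    simp [Module.Basis.tensorAlgebra, FreeAlgebra.basisFreeMonoid,
      FreeAlgebra.equivMonoidAlgebraFreeMonoid]

theorem range_ι_pow_eq_span (n : ℕ) :
    LinearMap.range (TensorAlgebra.ι K (M := L)) ^ n =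
      Submodule.span K (word b '' {w | w.length = n}) := by
  have hrange : LinearMap.range (TensorAlgebra.ι K (M := L)) =
      Submodule.span K (Set.range fun x => TensorAlgebra.ι K (b x)) := by
    rw [LinearMap.range_eq_map, ← b.span_eq, Submodule.map_span, ← Set.range_comp]
    rfl
  rw [hrange, Submodule.span_pow]
  congr 1
  ext t
  rw [Set.mem_pow]
  constructor
  · rintro ⟨f, rfl⟩
    choose x hx using fun i => (f i).2
    exact ⟨List.ofFn x, List.length_ofFn, by
      simp only [word, List.map_ofFn, Function.comp_def, hx]⟩
  · rintro ⟨w, rfl, rfl⟩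
    exact ⟨fun i => ⟨_, w.get i, rfl⟩, by
      conv_rhs => rw [word, ← List.ofFn_get w, List.map_ofFn]
      rfl⟩

theorem word_mem_range_ι_pow (w : List X) :
    word b w ∈ LinearMap.range (TensorAlgebra.ι K (M := L)) ^ w.length :=
  range_ι_pow_eq_span b w.length ▸ Submodule.subset_span ⟨w, rfl, rfl⟩

theorem word_mem_tensorFiltration {w : List X} {n : ℤ} (hw : (w.length : ℤ) ≤ n) :
    word b w ∈ tensorFiltration K L n :=
  pow_le_tensorFiltration hw (word_mem_range_ι_pow b w)

theorem tensorFiltration_eq_span (n : ℤ) :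
    tensorFiltration K L n = Submodule.span K (word b '' {w | (w.length : ℤ) ≤ n}) := by
  refine le_antisymm (iSup₂_le fun m hm => ?_) (Submodule.span_le.2 ?_)
  · rw [range_ι_pow_eq_span b]
    exact Submodule.span_mono (Set.image_mono fun w hw => (congrArg Nat.cast hw).trans_le hm)
  · rintro _ ⟨w, hw, rfl⟩
    exact word_mem_tensorFiltration b hw

/-- The linear map on `T(L)` with prescribed values on words. -/
def extendWords (F : List X → V) : TensorAlgebra K L →ₗ[K] V :=
  b.tensorAlgebra.constr K fun w => F w.toList

@[simp] theorem extendWords_word (F : List X → V) (w : List X) :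
    extendWords b F (word b w) = F w := by
  have h := b.tensorAlgebra.constr_basis K (fun w => F w.toList) (FreeMonoid.ofList w)
  rwa [tensorAlgebra_basis_apply] at h

theorem extendWords_word_mul_ι_mul_word (F : List X → V) (u v : List X) (a : L) :
    extendWords b F (word b u * TensorAlgebra.ι K a * word b v) =
      b.constr K (fun z => F (u ++ z :: v)) a := by
  refine LinearMap.congr_fun (f := extendWords b F ∘ₗ LinearMap.mulLeftRight K (word b u, word b v)
    ∘ₗ TensorAlgebra.ι K) (b.ext fun z => ?_) a
  rw [b.constr_basis, ← extendWords_word b F]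
  simp [mul_assoc]

end Words

section Relators

variable {K L A : Type*} [Field K] [AddCommGroup L] [Module K L] [Ring A] [Algebra K A]

/-- The color commutator `s t - k t s`. -/
def colorComm (k : K) : A →ₗ[K] A →ₗ[K] A := LinearMap.mul K A - k • (LinearMap.mul K A).flip

@[simp] theorem colorComm_apply (k : K) (s t : A) : colorComm k s t = s * t - k • (t * s) := rfl

theorem colorComm_add_smul_colorComm_swap {k k' : K} (h : k * k' = 1) (s t : A) :
    colorComm k s t + k • colorComm k' t s = 0 := by
  simp only [colorComm_apply, smul_sub, smul_smul, h]
  module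

theorem colorComm_braid (k l m : K) (x y z : A) :
    colorComm k x y * z + k • (y * colorComm l x z) + (k * l) • (colorComm m y z * x) =
      x * colorComm m y z + m • (colorComm l x z * y) + (m * l) • (z * colorComm k x y) := by
  simp only [colorComm_apply, mul_sub, sub_mul, smul_mul_assoc, mul_smul_comm, mul_assoc]
  module

variable (br : L →ₗ[K] L →ₗ[K] L) (ω : L →ₗ[K] L →ₗ[K] K)

/-- The terms `[a, c] + ω(a, c)` of order less than two of the relations of `U_ω(L)`. -/
def lowerTerm : L →ₗ[K] L →ₗ[K] TensorAlgebra K L :=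
  br.compr₂ (TensorAlgebra.ι K) + ω.compr₂ (Algebra.linearMap K (TensorAlgebra K L))

theorem lowerTerm_apply (a c : L) :
    lowerTerm br ω a c = TensorAlgebra.ι K (br a c) + algebraMap K _ (ω a c) := rfl

/-- The relator `a ⊗ c - k c ⊗ a - [a, c] - ω(a, c)`; those with `k = ε(|a|, |c|)` define
`U_ω(L)`. -/
def relator (k : K) : L →ₗ[K] L →ₗ[K] TensorAlgebra K L :=
  (colorComm k).compl₁₂ (TensorAlgebra.ι K) (TensorAlgebra.ι K) - lowerTerm br ω

theorem relator_apply (k : K) (a c : L) :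
    relator br ω k a c =
      colorComm k (TensorAlgebra.ι K a) (TensorAlgebra.ι K c) - lowerTerm br ω a c := rfl

theorem lowerTerm_mem_tensorFiltration (a c : L) : lowerTerm br ω a c ∈ tensorFiltration K L 1 := by
  refine add_mem (pow_le_tensorFiltration (m := 1) (by simp) ?_)
    (pow_le_tensorFiltration (m := 0) (by simp) ?_)
  · rw [pow_one]
    exact LinearMap.mem_range_self _ _
  · rw [pow_zero]
    exact Submodule.algebraMap_mem _

end Relators

section Straighten

variable {X K L V : Type*} [Field K] [AddCommGroup L] [Module K L] [AddCommGroup V] [Module K V]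
variable (b : Module.Basis X K L) (br : L →ₗ[K] L →ₗ[K] L) (ω : L →ₗ[K] L →ₗ[K] K)
  (e : X → X → K)

/-- The value of `Φ` on the relator of `x` and `y` between the words `u` and `v`. -/
def wordDefect (Φ : TensorAlgebra K L →ₗ[K] V) (u : List X) (x y : X) (v : List X) : V :=
  Φ (word b u * relator br ω (e x y) (b x) (b y) * word b v)

theorem wordDefect_eq (Φ : TensorAlgebra K L →ₗ[K] V) (u : List X) (x y : X) (v : List X) :
    wordDefect b br ω e Φ u x y v =
      Φ (word b (u ++ x :: y :: v)) - e x y • Φ (word b (u ++ y :: x :: v)) -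
        Φ (word b u * lowerTerm br ω (b x) (b y) * word b v) := by
  rw [← map_smul, ← map_sub, ← map_sub, wordDefect, relator_apply]
  simp only [word_append, word_cons, colorComm_apply, mul_sub, sub_mul, mul_smul_comm,
    smul_mul_assoc, mul_assoc]

variable [LinearOrder X] (nf : List X → V)

open Classical in
/-- The value of a word, computed by rewriting it with the relations of `U_ω(L)` at a chosen place;
words which cannot be rewritten have the prescribed values `nf`. -/
def straighten (w : List X) : V :=
  if h : Nonempty (RedexOccurrence e w) then
    let lower : V :=
      b.constr K (fun z => straighten (h.some.left ++ z :: h.some.right))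
        (br (b h.some.fst) (b h.some.snd)) +
      ω (b h.some.fst) (b h.some.snd) • straighten (h.some.left ++ h.some.right)
    if h.some.snd < h.some.fst then
      e h.some.fst h.some.snd •
        straighten (h.some.left ++ h.some.snd :: h.some.fst :: h.some.right) + lower
    else (2 : K)⁻¹ • lower
  else nf w
termination_by (w.length, inversions w)
decreasing_by
  all_goals
    have hlength := congrArg List.length h.some.eq_append
    simp only [List.length_append, List.length_cons] at hlength
  · exact Prod.Lex.left _ _ (by simp only [List.length_append, List.length_cons]; omega)
  · exact Prod.Lex.left _ _ (by simp only [List.length_append]; omega)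
  · rename_i hlt
    refine Prod.Lex.right' _ (by simp only [List.length_append, List.length_cons]; omega) ?_
    conv_rhs => rw [h.some.eq_append]
    exact inversions_swap_lt _ _ hlt

theorem straighten_of_isEmpty {w : List X} (h : IsEmpty (RedexOccurrence e w)) :
    straighten b br ω e nf w = nf w := by
  rw [straighten, dif_neg (not_nonempty_iff.2 h)]

theorem exists_wordDefect_straighten_eq_zero (h2 : (2 : K) ≠ 0) {w : List X}
    (h : Nonempty (RedexOccurrence e w)) :
    ∃ r : RedexOccurrence e w, wordDefect b br ω e (extendWords b (straighten b br ω e nf))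
      r.left r.fst r.snd r.right = 0 := by
  refine ⟨h.some, ?_⟩
  have hw := straighten.eq_1 b br ω e nf w
  rw [dif_pos h] at hw
  rw [wordDefect_eq, lowerTerm_apply, mul_add, add_mul, map_add,
    extendWords_word_mul_ι_mul_word, Algebra.algebraMap_eq_smul_one, mul_smul_comm, smul_mul_assoc,
    mul_one, map_smul, ← word_append, extendWords_word, extendWords_word, extendWords_word,
    ← h.some.eq_append]
  split_ifs at hw with hlt
  · rw [hw]
    module
  · obtain ⟨heq, hodd⟩ := h.some.isRedex.resolve_left hlt
    have hswap : h.some.left ++ h.some.snd :: h.some.fst :: h.some.right = w := by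
      conv_rhs => rw [h.some.eq_append]
      rw [heq]
    rw [hswap, ← heq, hodd, hw, ← heq]
    match_scalars <;> field_simp <;> norm_num

end Straighten

section HomogeneousBasis

variable {K G L V X : Type*} [Field K] [AddCommGroup L] [Module K L] [AddCommGroup V] [Module K V]

/-- A basis of homogeneous elements, `d x` being the degree of `b x`. -/
def IsHomogeneousBasis (𝓛 : G → Submodule K L) (b : Module.Basis X K L) (d : X → G) : Prop :=
  ∀ g, Submodule.span K (b '' (d ⁻¹' {g})) = 𝓛 g

theorem exists_isHomogeneousBasis.{u, v, w} {K : Type u} {G : Type v} {L : Type w} [Field K]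
    [AddCommGroup L] [Module K L] [DecidableEq G] {𝓛 : G → Submodule K L}
    (h : DirectSum.IsInternal 𝓛) :
    ∃ (X : Type (max v w)) (b : Module.Basis X K L) (d : X → G), IsHomogeneousBasis 𝓛 b d := by
  let b := h.collectedBasis fun g => Module.Free.chooseBasis K (𝓛 g)
  refine ⟨_, b, Sigma.fst, fun g => le_antisymm (Submodule.span_le.2 ?_) fun a ha => ?_⟩
  · rintro _ ⟨x, rfl, rfl⟩
    exact h.collectedBasis_mem _ x
  · refine (b.mem_span_image).2 fun x hx => ?_
    by_contra hne
    exact Finsupp.mem_support_iff.1 hx (h.collectedBasis_repr_of_mem_ne _ (Ne.symm hne) ha)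

variable {𝓛 : G → Submodule K L} {b : Module.Basis X K L} {d : X → G}

theorem IsHomogeneousBasis.mem (hb : IsHomogeneousBasis 𝓛 b d) (x : X) : b x ∈ 𝓛 (d x) :=
  hb (d x) ▸ Submodule.subset_span ⟨x, rfl, rfl⟩

theorem IsHomogeneousBasis.bilin_eq_zero (hb : IsHomogeneousBasis 𝓛 b d) {g h : G}
    (B : L →ₗ[K] L →ₗ[K] V) (hB : ∀ x y, d x = g → d y = h → B (b x) (b y) = 0) {a c : L}
    (ha : a ∈ 𝓛 g) (hc : c ∈ 𝓛 h) : B a c = 0 := by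
  rw [← hb] at ha hc
  refine LinearMap.BilinMap.apply_apply_mem_of_mem_span ⊥ _ _ B ?_ a c ha hc
  rintro _ ⟨x, hx, rfl⟩ _ ⟨y, hy, rfl⟩
  exact hB x y hx hy

end HomogeneousBasis

section Identities

variable {K G L M : Type*} [Field K] [AddCommGroup G] [AddCommGroup L] [Module K L]
  [AddCommGroup M] [Module K M]
variable {ε : G → G → Kˣ} {𝓛 : G → Submodule K L} {br : L →ₗ[K] L →ₗ[K] L} {ω : L →ₗ[K] L →ₗ[K] K}

namespace IsAntisymmBicharacter

theorem coe_mul_swap (hε : IsAntisymmBicharacter ε) (g h : G) : (ε g h : K) * ε h g = 1 := by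
  rw [← Units.val_mul, hε.mul_swap, Units.val_one]

theorem coe_add_left (hε : IsAntisymmBicharacter ε) (g h k : G) :
    (ε (g + h) k : K) = ε g k * ε h k := by
  rw [hε.add_left, Units.val_mul]

theorem coe_add_right (hε : IsAntisymmBicharacter ε) (g h k : G) :
    (ε g (h + k) : K) = ε g h * ε g k := by
  rw [hε.add_right, Units.val_mul]

theorem zero_right (hε : IsAntisymmBicharacter ε) (g : G) : ε g 0 = 1 := by
  simpa using hε.add_right g 0 0

theorem zero_left (hε : IsAntisymmBicharacter ε) (g : G) : ε 0 g = 1 := by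
  simpa using hε.add_left 0 0 g

end IsAntisymmBicharacter

theorem IsScalarTwoCocycle.mul_coe_add_right (hε : IsAntisymmBicharacter ε)
    (hω : IsScalarTwoCocycle ε 𝓛 br ω) {g h : G} {x y : L} (hx : x ∈ 𝓛 g) (hy : y ∈ 𝓛 h) (k : G) :
    (ε k (g + h) : K) * ω x y = ω x y := by
  by_cases hgh : g + h = 0
  · rw [hgh, hε.zero_right, Units.val_one, one_mul]
  · rw [hω.degree_zero hx hy hgh, mul_zero]

theorem IsScalarTwoCocycle.mul_coe_add_left (hε : IsAntisymmBicharacter ε)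
    (hω : IsScalarTwoCocycle ε 𝓛 br ω) {g h : G} {x y : L} (hx : x ∈ 𝓛 g) (hy : y ∈ 𝓛 h) (k : G) :
    (ε (g + h) k : K) * ω x y = ω x y := by
  by_cases hgh : g + h = 0
  · rw [hgh, hε.zero_left, Units.val_one, one_mul]
  · rw [hω.degree_zero hx hy hgh, mul_zero]

theorem IsScalarTwoCocycle.colorComm_ι_lowerTerm (hε : IsAntisymmBicharacter ε)
    (hω : IsScalarTwoCocycle ε 𝓛 br ω) {h k : G} {y z : L} (hy : y ∈ 𝓛 h) (hz : z ∈ 𝓛 k) (g : G)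
    (x : L) : colorComm (ε g (h + k) : K) (TensorAlgebra.ι K x) (lowerTerm br ω y z) =
      relator br ω (ε g (h + k)) x (br y z) + lowerTerm br ω x (br y z) := by
  rw [relator_apply, sub_add_cancel, lowerTerm_apply, map_add, add_eq_left, colorComm_apply,
    ← Algebra.commutes, ← Algebra.smul_def, smul_smul, hω.mul_coe_add_right hε hy hz, sub_self]

theorem IsScalarTwoCocycle.colorComm_lowerTerm_ι (hε : IsAntisymmBicharacter ε)
    (hω : IsScalarTwoCocycle ε 𝓛 br ω) {g h : G} {x y : L} (hx : x ∈ 𝓛 g) (hy : y ∈ 𝓛 h) (k : G)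
    (z : L) : colorComm (ε (g + h) k : K) (lowerTerm br ω x y) (TensorAlgebra.ι K z) =
      relator br ω (ε (g + h) k) (br x y) z + lowerTerm br ω (br x y) z := by
  rw [relator_apply, sub_add_cancel, lowerTerm_apply, map_add, LinearMap.add_apply, add_eq_left,
    colorComm_apply, ← Algebra.commutes, ← Algebra.smul_def, smul_smul,
    hω.mul_coe_add_left hε hx hy, sub_self]

variable [DecidableEq G]

theorem IsColorLieAlgebra.lowerTerm_skew (hL : IsColorLieAlgebra ε 𝓛 br)
    (hω : IsScalarTwoCocycle ε 𝓛 br ω) {g h : G} {x y : L} (hx : x ∈ 𝓛 g) (hy : y ∈ 𝓛 h) :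
    lowerTerm br ω x y = -((ε g h : K) • lowerTerm br ω y x) := by
  simp only [lowerTerm_apply, hL.skew hx hy, hω.skew hx hy, map_neg, map_smul,
    Algebra.algebraMap_eq_smul_one]
  module

theorem IsColorLieAlgebra.lowerTerm_jacobi (hL : IsColorLieAlgebra ε 𝓛 br)
    (hω : IsScalarTwoCocycle ε 𝓛 br ω) {g h k : G} {x y z : L} (hx : x ∈ 𝓛 g) (hy : y ∈ 𝓛 h)
    (hz : z ∈ 𝓛 k) :
    (ε k g : K) • lowerTerm br ω x (br y z) + (ε g h : K) • lowerTerm br ω y (br z x) +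
      (ε h k : K) • lowerTerm br ω z (br x y) = 0 := by
  have hbr := congrArg (TensorAlgebra.ι K) (hL.jacobi hx hy hz)
  have hsc := congrArg (algebraMap K (TensorAlgebra K L)) (hω.cocycle hx hy hz)
  simp only [map_add, map_smul, map_zero, ← smul_eq_mul] at hbr hsc
  simp only [lowerTerm_apply, Algebra.algebraMap_eq_smul_one] at hsc ⊢
  linear_combination (norm := module) hbr + hsc

theorem IsColorLieAlgebra.lowerTerm_leibniz (hε : IsAntisymmBicharacter ε)
    (hL : IsColorLieAlgebra ε 𝓛 br) (hω : IsScalarTwoCocycle ε 𝓛 br ω) {g h k : G} {x y z : L}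
    (hx : x ∈ 𝓛 g) (hy : y ∈ 𝓛 h) (hz : z ∈ 𝓛 k) :
    lowerTerm br ω x (br y z) =
      lowerTerm br ω (br x y) z - (ε h k : K) • lowerTerm br ω (br x z) y := by
  have hgk := hε.coe_mul_swap g k
  have hhk := hε.coe_mul_swap h k
  have hjacobi := congrArg ((ε g k : K) • ·) (hL.lowerTerm_jacobi hω hx hy hz)
  rw [hL.lowerTerm_skew hω (hL.bracket_mem hx hy) hz,
    hL.lowerTerm_skew hω (hL.bracket_mem hx hz) hy, hL.skew hx hz, map_neg, map_smul,
    hε.coe_add_left, hε.coe_add_left]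
  simp only [smul_add, smul_zero, smul_smul, hgk, one_smul] at hjacobi
  have hsolve : lowerTerm br ω x (br y z) =
      -(((ε g k : K) * ε g h) • lowerTerm br ω y (br z x)) -
        ((ε g k : K) * ε h k) • lowerTerm br ω z (br x y) := by
    linear_combination (norm := module) hjacobi
  rw [hsolve]
  match_scalars
  · linear_combination (ε g k : K) * ε g h * hhk
  · ring

theorem IsColorLieAlgebra.relator_skew (hε : IsAntisymmBicharacter ε)
    (hL : IsColorLieAlgebra ε 𝓛 br) (hω : IsScalarTwoCocycle ε 𝓛 br ω) {g h : G} {x y : L}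
    (hx : x ∈ 𝓛 g) (hy : y ∈ 𝓛 h) :
    relator br ω (ε g h : K) x y + (ε g h : K) • relator br ω (ε h g : K) y x = 0 := by
  rw [relator_apply, relator_apply, hL.lowerTerm_skew hω hx hy]
  linear_combination (norm := module) colorComm_add_smul_colorComm_swap (hε.coe_mul_swap g h)
    (TensorAlgebra.ι K x) (TensorAlgebra.ι K y)

theorem IsColorLieAlgebra.relator_braid (hε : IsAntisymmBicharacter ε)
    (hL : IsColorLieAlgebra ε 𝓛 br) (hω : IsScalarTwoCocycle ε 𝓛 br ω) {g h k : G} {x y z : L}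
    (hx : x ∈ 𝓛 g) (hy : y ∈ 𝓛 h) (hz : z ∈ 𝓛 k) :
    relator br ω (ε g h : K) x y * TensorAlgebra.ι K z +
        (ε g h : K) • (TensorAlgebra.ι K y * relator br ω (ε g k : K) x z) +
        ((ε g h : K) * ε g k) • (relator br ω (ε h k : K) y z * TensorAlgebra.ι K x) -
      (TensorAlgebra.ι K x * relator br ω (ε h k : K) y z +
        (ε h k : K) • (relator br ω (ε g k : K) x z * TensorAlgebra.ι K y) +
        ((ε h k : K) * ε g k) • (TensorAlgebra.ι K z * relator br ω (ε g h : K) x y)) =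
    relator br ω (ε g (h + k) : K) x (br y z) - relator br ω (ε (g + h) k : K) (br x y) z +
      (ε h k : K) • relator br ω (ε (g + k) h : K) (br x z) y := by
  have hx_yz := hω.colorComm_ι_lowerTerm hε hy hz g x
  have hxy_z := hω.colorComm_lowerTerm_ι hε hx hy k z
  have hxz_y := congrArg ((ε h k : K) • ·) (hω.colorComm_lowerTerm_ι hε hx hz h y)
  have hscal : (ε h k : K) * ε (g + k) h = ε g h := by
    rw [hε.coe_add_left]
    linear_combination (ε g h : K) * hε.coe_mul_swap h k
  simp only [colorComm_apply, smul_sub, smul_add, smul_smul, hscal] at hx_yz hxy_z hxz_y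
  rw [hε.coe_add_right] at hx_yz ⊢
  rw [hε.coe_add_left] at hxy_z ⊢
  have hbraid := colorComm_braid (ε g h : K) (ε g k) (ε h k)
    (TensorAlgebra.ι K x) (TensorAlgebra.ι K y) (TensorAlgebra.ι K z)
  have hleibniz := hL.lowerTerm_leibniz hε hω hx hy hz
  rw [relator_apply br ω _ x y, relator_apply br ω _ x z, relator_apply br ω _ y z]
  simp only [mul_sub, sub_mul]
  linear_combination (norm := module) hbraid + hx_yz - hxy_z + hxz_y + hleibniz

end Identities

section TensorFiltration

variable {K L : Type*} [Field K] [AddCommGroup L] [Module K L]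

theorem tensorFiltration_mono : Monotone (tensorFiltration K L) := fun _ _ h =>
  iSup₂_le fun _ hm => pow_le_tensorFiltration (hm.trans h)

theorem mul_mem_tensorFiltration {i j : ℤ} {s t : TensorAlgebra K L}
    (hs : s ∈ tensorFiltration K L i) (ht : t ∈ tensorFiltration K L j) :
    s * t ∈ tensorFiltration K L (i + j) :=
  tensorFiltration_mul_le i j (Submodule.mul_mem_mul hs ht)

theorem exists_mem_tensorFiltration (t : TensorAlgebra K L) :
    ∃ n : ℕ, t ∈ tensorFiltration K L n := by
  induction t using TensorAlgebra.induction with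
  | algebraMap k =>
    exact ⟨0, pow_le_tensorFiltration le_rfl (by rw [pow_zero]; exact Submodule.algebraMap_mem k)⟩
  | ι a =>
    exact ⟨1, pow_le_tensorFiltration le_rfl (by rw [pow_one]; exact LinearMap.mem_range_self _ a)⟩
  | mul s t hs ht =>
    obtain ⟨⟨i, hs⟩, j, ht⟩ := hs, ht
    exact ⟨i + j, by exact_mod_cast mul_mem_tensorFiltration hs ht⟩
  | add s t hs ht =>
    obtain ⟨⟨i, hs⟩, j, ht⟩ := hs, ht
    exact ⟨max i j, add_mem (tensorFiltration_mono (by simp) hs)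
      (tensorFiltration_mono (by simp) ht)⟩

theorem tensorFiltration_eq_bot_of_neg {n : ℤ} (hn : n < 0) : tensorFiltration K L n = ⊥ :=
  iSup₂_eq_bot.2 fun m hm => by lia

theorem exists_range_ι_pow_sub_mem {n : ℕ} {t : TensorAlgebra K L}
    (ht : t ∈ tensorFiltration K L n) :
    ∃ s ∈ LinearMap.range (TensorAlgebra.ι K (M := L)) ^ n,
      s - t ∈ tensorFiltration K L (n - 1) := by
  have hle : tensorFiltration K L n ≤
      LinearMap.range (TensorAlgebra.ι K (M := L)) ^ n ⊔ tensorFiltration K L (n - 1) := by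
    refine iSup₂_le fun m hm => ?_
    rcases hm.eq_or_lt with heq | hlt
    · rw [Int.ofNat_inj.1 heq]
      exact le_sup_left
    · exact (pow_le_tensorFiltration (Int.le_sub_one_of_lt hlt)).trans le_sup_right
  obtain ⟨s, hs, r, hr, rfl⟩ := Submodule.mem_sup.1 (hle ht)
  exact ⟨s, hs, by simpa using hr⟩

end TensorFiltration

section Kill

variable {K G L V X : Type*} [Field K] [AddCommGroup L] [Module K L] [AddCommGroup V] [Module K V]

/-- `Φ` vanishes on the elements of order at most `n` of the ideal which defines `U_ω(L)` that are
visibly so: the products `s r t` of order at most `n`, with `r` a relator of order two. -/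
def KillsRelators (ε : G → G → Kˣ) (𝓛 : G → Submodule K L) (br : L →ₗ[K] L →ₗ[K] L)
    (ω : L →ₗ[K] L →ₗ[K] K) (Φ : TensorAlgebra K L →ₗ[K] V) (n : ℤ) : Prop :=
  ∀ ⦃i j : ℤ⦄, i + j + 2 ≤ n → ∀ ⦃s t : TensorAlgebra K L⦄, s ∈ tensorFiltration K L i →
    t ∈ tensorFiltration K L j → ∀ ⦃g h : G⦄ ⦃a c : L⦄, a ∈ 𝓛 g → c ∈ 𝓛 h →
      Φ (s * relator br ω (ε g h : K) a c * t) = 0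

variable {ε : G → G → Kˣ} {𝓛 : G → Submodule K L} {br : L →ₗ[K] L →ₗ[K] L} {ω : L →ₗ[K] L →ₗ[K] K}
  {b : Module.Basis X K L} {d : X → G} {Φ : TensorAlgebra K L →ₗ[K] V} {n : ℤ}

/-- The scalars `ε(|b x|, |b y|)` for a homogeneous basis `b` with degrees `d`. -/
abbrev basisSign (ε : G → G → Kˣ) (d : X → G) (x y : X) : K := ε (d x) (d y)

theorem killsRelators_of_wordDefect_eq_zero (hb : IsHomogeneousBasis 𝓛 b d)
    (hΦ : ∀ u x y v, ((u ++ x :: y :: v).length : ℤ) ≤ n →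
      wordDefect b br ω (basisSign ε d) Φ u x y v = 0) : KillsRelators ε 𝓛 br ω Φ n := by
  intro i j hij s t hs ht g h a c ha hc
  have hword (u v : List X) (huv : (u.length : ℤ) + v.length + 2 ≤ n) :
      Φ (word b u * relator br ω (ε g h : K) a c * word b v) = 0 := by
    refine hb.bilin_eq_zero
      ((relator br ω (ε g h : K)).compr₂ (Φ ∘ₗ LinearMap.mulLeftRight K (word b u, word b v)))
      ?_ ha hc
    rintro x y rfl rfl
    exact hΦ u x y v (by simp only [List.length_append, List.length_cons]; push_cast; lia)
  rw [tensorFiltration_eq_span b] at hs ht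
  refine LinearMap.BilinMap.apply_apply_mem_of_mem_span ⊥ _ _
    (((LinearMap.mul K _).comp (LinearMap.mulRight K (relator br ω (ε g h : K) a c))).compr₂ Φ)
    ?_ s t hs ht
  rintro _ ⟨u, hu, rfl⟩ _ ⟨v, hv, rfl⟩
  exact hword u v (le_trans (add_le_add_left (add_le_add hu hv) 2) hij)

theorem relator_comm (k l : K) (x y z w : L) (s m t : TensorAlgebra K L) :
    s * relator br ω k x y * (m * (TensorAlgebra.ι K z * (TensorAlgebra.ι K w * t))) +
        k • (s * (TensorAlgebra.ι K y * (TensorAlgebra.ι K x * m)) * relator br ω l z w * t) -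
      (s * (TensorAlgebra.ι K x * (TensorAlgebra.ι K y * m)) * relator br ω l z w * t +
        l • (s * relator br ω k x y *
          (m * (TensorAlgebra.ι K w * (TensorAlgebra.ι K z * t))))) =
    s * relator br ω k x y * (m * lowerTerm br ω z w * t) -
      s * lowerTerm br ω x y * m * relator br ω l z w * t := by
  simp only [relator_apply, colorComm_apply, mul_sub, sub_mul, mul_smul_comm, smul_mul_assoc,
    mul_assoc]
  module

theorem map_mul_relator_mul_eq_zero (hΦ : ∀ n : ℕ, KillsRelators ε 𝓛 br ω Φ n)
    (s t : TensorAlgebra K L) {g h : G} {a c : L} (ha : a ∈ 𝓛 g) (hc : c ∈ 𝓛 h) :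
    Φ (s * relator br ω (ε g h : K) a c * t) = 0 := by
  obtain ⟨⟨i, hs⟩, j, ht⟩ := exists_mem_tensorFiltration s, exists_mem_tensorFiltration t
  exact hΦ (i + j + 2) (by push_cast; rfl) hs ht ha hc

variable [AddCommGroup G] [DecidableEq G]

theorem KillsRelators.isDefect (hε : IsAntisymmBicharacter ε) (hL : IsColorLieAlgebra ε 𝓛 br)
    (hω : IsScalarTwoCocycle ε 𝓛 br ω) (hb : IsHomogeneousBasis 𝓛 b d) {n : ℕ}
    (hΦ : KillsRelators ε 𝓛 br ω Φ (n - 1)) :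
    IsDefect (basisSign ε d) n (wordDefect b br ω (basisSign ε d) Φ) where
  skew u x y v _ := by
    have hskew := congrArg (fun r => Φ (word b u * r * word b v))
      (hL.relator_skew hε hω (hb.mem x) (hb.mem y))
    simpa [wordDefect, mul_add, add_mul] using hskew
  comm u x y m z w v hn := by
    have hleft : Φ (word b u * relator br ω (basisSign ε d x y) (b x) (b y) *
        (word b m * lowerTerm br ω (b z) (b w) * word b v)) = 0 :=
      hΦ (i := u.length) (j := m.length + 1 + v.length)
        (by simp only [← hn, List.length_append, List.length_cons]; push_cast; lia)
        (word_mem_tensorFiltration b le_rfl)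
        (mul_mem_tensorFiltration (mul_mem_tensorFiltration (word_mem_tensorFiltration b le_rfl)
          (lowerTerm_mem_tensorFiltration br ω _ _)) (word_mem_tensorFiltration b le_rfl))
        (hb.mem x) (hb.mem y)
    have hright : Φ (word b u * lowerTerm br ω (b x) (b y) * word b m *
        relator br ω (basisSign ε d z w) (b z) (b w) * word b v) = 0 :=
      hΦ (i := u.length + 1 + m.length) (j := v.length)
        (by simp only [← hn, List.length_append, List.length_cons]; push_cast; lia)
        (mul_mem_tensorFiltration (mul_mem_tensorFiltration (word_mem_tensorFiltration b le_rfl)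
          (lowerTerm_mem_tensorFiltration br ω _ _)) (word_mem_tensorFiltration b le_rfl))
        (word_mem_tensorFiltration b le_rfl) (hb.mem z) (hb.mem w)
    have hcomm := congrArg Φ (relator_comm (br := br) (ω := ω) (basisSign ε d x y)
      (basisSign ε d z w) (b x) (b y) (b z) (b w) (word b u) (word b m) (word b v))
    rw [map_sub, map_sub, hleft, hright, sub_zero, sub_eq_zero] at hcomm
    simpa [wordDefect] using hcomm
  braid u x y z v hn := by
    have hkill {g h : G} {a c : L} (ha : a ∈ 𝓛 g) (hc : c ∈ 𝓛 h) :
        Φ (word b u * relator br ω (ε g h : K) a c * word b v) = 0 :=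
      hΦ (i := u.length) (j := v.length)
        (by simp only [← hn, List.length_append, List.length_cons]; push_cast; lia)
        (word_mem_tensorFiltration b le_rfl) (word_mem_tensorFiltration b le_rfl) ha hc
    have hx := hb.mem x
    have hy := hb.mem y
    have hz := hb.mem z
    have hbraid := congrArg (fun r => Φ (word b u * r * word b v))
      (hL.relator_braid hε hω hx hy hz)
    simp only [mul_add, add_mul, mul_sub, sub_mul, map_add, map_sub, mul_smul_comm, smul_mul_assoc,
      map_smul, hkill hx (hL.bracket_mem hy hz), hkill (hL.bracket_mem hx hy) hz,
      hkill (hL.bracket_mem hx hz) hy, smul_zero, sub_zero, add_zero] at hbraid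
    simpa [wordDefect, mul_assoc] using sub_eq_zero.1 hbraid

theorem killsRelators_of_exists_redexOccurrence [LinearOrder X] (h2 : (2 : K) ≠ 0)
    (h3 : (3 : K) ≠ 0) (hε : IsAntisymmBicharacter ε) (hL : IsColorLieAlgebra ε 𝓛 br)
    (hω : IsScalarTwoCocycle ε 𝓛 br ω) (hb : IsHomogeneousBasis 𝓛 b d)
    (hΦ : ∀ w, Nonempty (RedexOccurrence (basisSign ε d) w) →
      ∃ r : RedexOccurrence (basisSign ε d) w,
        wordDefect b br ω (basisSign ε d) Φ r.left r.fst r.snd r.right = 0) (n : ℕ) :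
    KillsRelators ε 𝓛 br ω Φ n := by
  induction n using Nat.strong_induction_on with
  | _ n ih =>
  refine killsRelators_of_wordDefect_eq_zero hb fun u x y v hn => ?_
  have hpos : 0 < (u ++ x :: y :: v).length := by simp
  have hprev : KillsRelators ε 𝓛 br ω Φ ((u ++ x :: y :: v).length - 1 : ℤ) := by
    have hlt := ih ((u ++ x :: y :: v).length - 1)
      ((Nat.sub_one_lt hpos.ne').trans_le (by exact_mod_cast hn))
    rwa [Nat.cast_sub hpos, Nat.cast_one] at hlt
  exact (hprev.isDefect hε hL hω hb).eq_zero h2 h3 (fun x y => hε.coe_mul_swap _ _)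
    (fun w _ => hΦ w) rfl

end Kill

/-! ### A linear map to the symmetric algebra -/

section Descent

theorem eq_of_mkAlgHom_eq {K A V : Type*} [CommSemiring K] [Semiring A] [Algebra K A]
    [AddCommMonoid V] [Module K V] {r : A → A → Prop} (Φ : A →ₗ[K] V)
    (hΦ : ∀ x y, r x y → ∀ s t, Φ (s * x * t) = Φ (s * y * t)) {x y : A}
    (h : RingQuot.mkAlgHom K r x = RingQuot.mkAlgHom K r y) : Φ x = Φ y := by
  let c : RingCon A :=
    { r := fun x y => ∀ s t, Φ (s * x * t) = Φ (s * y * t)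
      iseqv := ⟨fun _ _ _ => rfl, fun h s t => (h s t).symm, fun h h' s t => (h s t).trans (h' s t)⟩
      add' := fun h h' s t => by simp only [mul_add, add_mul, map_add, h s t, h' s t]
      mul' := fun {x x' y y'} h h' s t => by
        have hxy := (h s (y * t)).trans (by simpa only [mul_assoc] using h' (s * x') t)
        simpa only [mul_assoc] using hxy }
  have hc : ∀ ⦃x y⦄, r x y → c.mk' x = c.mk' y := fun x y hxy => c.eq.2 (hΦ x y hxy)
  have hmk : RingQuot.mkRingHom r x = RingQuot.mkRingHom r y := by
    rwa [← RingQuot.mkAlgHom_coe K]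
  have hxy := congrArg (RingQuot.lift ⟨c.mk', hc⟩) hmk
  rw [RingQuot.lift_mkRingHom_apply, RingQuot.lift_mkRingHom_apply] at hxy
  simpa using c.eq.1 hxy 1 1

variable {K G L V : Type*} [Field K] [AddCommGroup L] [Module K L] [AddCommGroup V] [Module K V]
  {ε : G → G → Kˣ} {𝓛 : G → Submodule K L} {br : L →ₗ[K] L →ₗ[K] L} {ω : L →ₗ[K] L →ₗ[K] K}

theorem envMk_surjective : Function.Surjective (envMk ε 𝓛 br ω) :=
  RingQuot.mkAlgHom_surjective K _

theorem envMk_relator [AddCommGroup G] {g h : G} {a c : L} (ha : a ∈ 𝓛 g) (hc : c ∈ 𝓛 h) :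
    envMk ε 𝓛 br ω (relator br ω (ε g h : K) a c) = 0 := by
  rw [relator_apply, lowerTerm_apply, colorComm_apply]
  simp only [map_sub, map_add, map_smul, map_mul, AlgHom.commutes]
  exact sub_eq_zero.2 (envι_rel ε 𝓛 br ω ha hc)

theorem exists_comp_envMk_eq {Φ : TensorAlgebra K L →ₗ[K] V}
    (hΦ : ∀ n : ℕ, KillsRelators ε 𝓛 br ω Φ n) :
    ∃ Ψ : GenEnv ε 𝓛 br ω →ₗ[K] V, ∀ t, Ψ (envMk ε 𝓛 br ω t) = Φ t := by
  obtain ⟨σ, hσ⟩ := (envMk ε 𝓛 br ω).toLinearMap.exists_rightInverse_of_surjective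
    (LinearMap.range_eq_top.2 envMk_surjective)
  refine ⟨Φ ∘ₗ σ, fun t => eq_of_mkAlgHom_eq Φ ?_ (LinearMap.congr_fun hσ (envMk ε 𝓛 br ω t))⟩
  rintro _ _ ⟨ha, hc⟩ s t
  rw [mul_zero, zero_mul, map_zero, sub_sub]
  exact map_mul_relator_mul_eq_zero hΦ s t ha hc

end Descent

section LeadingTerms

variable {K G L X : Type*} [Field K] [AddCommGroup L] [Module K L]
  {ε : G → G → Kˣ} {𝓛 : G → Submodule K L} {br : L →ₗ[K] L →ₗ[K] L} {ω : L →ₗ[K] L →ₗ[K] K}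

theorem envFiltration_mono : Monotone (envFiltration ε 𝓛 br ω) := fun _ _ h =>
  Submodule.map_mono (tensorFiltration_mono h)

theorem envMk_mem_envFiltration {n : ℤ} {t : TensorAlgebra K L} (ht : t ∈ tensorFiltration K L n) :
    envMk ε 𝓛 br ω t ∈ envFiltration ε 𝓛 br ω n :=
  ⟨t, ht, rfl⟩

variable {b : Module.Basis X K L} {d : X → G} {Φ : TensorAlgebra K L →ₗ[K] SymAlg ε 𝓛}

theorem map_mem_envFiltration_of_word {n : ℤ}
    (hΦ : ∀ w : List X, (w.length : ℤ) ≤ n →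
      Φ (word b w) - envMk ε 𝓛 0 0 (word b w) ∈ envFiltration ε 𝓛 0 0 (w.length - 1))
    {t : TensorAlgebra K L} (ht : t ∈ tensorFiltration K L n) :
    Φ t ∈ envFiltration ε 𝓛 0 0 n := by
  rw [tensorFiltration_eq_span b] at ht
  refine Submodule.span_le (p := (envFiltration ε 𝓛 0 0 n).comap Φ).2 ?_ ht
  rintro _ ⟨w, hw, rfl⟩
  have hword : envMk ε 𝓛 0 0 (word b w) ∈ envFiltration ε 𝓛 0 0 n :=
    envMk_mem_envFiltration (word_mem_tensorFiltration b hw)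
  exact (Submodule.sub_mem_iff_left _ hword).1
    (envFiltration_mono (by have := Set.mem_ofPred_eq ▸ hw; lia) (hΦ w hw))

variable [AddCommGroup G]

theorem map_sub_envMk_sub_smul_swap (hb : IsHomogeneousBasis 𝓛 b d)
    (hΦ : ∀ n : ℕ, KillsRelators ε 𝓛 br ω Φ n) (u : List X) (x y : X) (v : List X) :
    (Φ (word b (u ++ x :: y :: v)) - envMk ε 𝓛 0 0 (word b (u ++ x :: y :: v))) -
        basisSign ε d x y •
          (Φ (word b (u ++ y :: x :: v)) - envMk ε 𝓛 0 0 (word b (u ++ y :: x :: v))) =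
      Φ (word b u * lowerTerm br ω (b x) (b y) * word b v) := by
  have hΦ_defect : wordDefect b br ω (basisSign ε d) Φ u x y v = 0 :=
    map_mul_relator_mul_eq_zero hΦ _ _ (hb.mem x) (hb.mem y)
  have hsym_defect : wordDefect b 0 0 (basisSign ε d) (envMk ε 𝓛 0 0).toLinearMap u x y v = 0 := by
    simp only [wordDefect, AlgHom.toLinearMap_apply, map_mul, envMk_relator (hb.mem x) (hb.mem y),
      mul_zero, zero_mul]
  rw [wordDefect_eq] at hΦ_defect hsym_defect
  simp only [AlgHom.toLinearMap_apply, lowerTerm_apply, LinearMap.zero_apply, map_zero, add_zero,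
    mul_zero, zero_mul, sub_zero] at hsym_defect
  linear_combination (norm := module) hΦ_defect - hsym_defect

variable [LinearOrder X]

theorem map_word_sub_envMk_mem (h2 : (2 : K) ≠ 0) (hb : IsHomogeneousBasis 𝓛 b d)
    (hΦ : ∀ n : ℕ, KillsRelators ε 𝓛 br ω Φ n)
    (hirr : ∀ w, IsEmpty (RedexOccurrence (basisSign ε d) w) →
      Φ (word b w) = envMk ε 𝓛 0 0 (word b w)) (w : List X) :
    Φ (word b w) - envMk ε 𝓛 0 0 (word b w) ∈ envFiltration ε 𝓛 0 0 (w.length - 1) := by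
  rcases isEmpty_or_nonempty (RedexOccurrence (basisSign ε d) w) with hw | ⟨u, x, y, v, hw, hxy⟩
  · rw [hirr w hw, sub_self]
    exact zero_mem _
  subst hw
  have hshort (w' : List X) (_ : (w'.length : ℤ) ≤ (u ++ x :: y :: v).length - 1) :
      Φ (word b w') - envMk ε 𝓛 0 0 (word b w') ∈ envFiltration ε 𝓛 0 0 (w'.length - 1) :=
    map_word_sub_envMk_mem h2 hb hΦ hirr w'
  have hlower : Φ (word b u * lowerTerm br ω (b x) (b y) * word b v) ∈
      envFiltration ε 𝓛 0 0 ((u ++ x :: y :: v).length - 1) := by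
    refine map_mem_envFiltration_of_word hshort (tensorFiltration_mono ?_ (mul_mem_tensorFiltration
      (mul_mem_tensorFiltration (word_mem_tensorFiltration b le_rfl)
        (lowerTerm_mem_tensorFiltration br ω _ _)) (word_mem_tensorFiltration b le_rfl)))
    simp only [List.length_append, List.length_cons]
    push_cast
    lia
  rw [← map_sub_envMk_sub_smul_swap hb hΦ] at hlower
  rcases hxy with hyx | ⟨rfl, hodd⟩
  · refine (Submodule.sub_mem_iff_left _ (Submodule.smul_mem _ _ ?_)).1 hlower
    have := inversions_swap_lt u v hyx
    have hswap := map_word_sub_envMk_mem h2 hb hΦ hirr (u ++ y :: x :: v)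
    simpa using hswap
  · rw [hodd, neg_one_smul, sub_neg_eq_add, ← two_smul K] at hlower
    exact (Submodule.smul_mem_iff _ h2).1 hlower
termination_by (w.length, inversions w)
decreasing_by
  all_goals subst hw
  · exact Prod.Lex.left _ _ (by lia)
  · exact Prod.Lex.right' _ (by simp) this

end LeadingTerms

section

variable {K G L : Type*} [Field K] [AddCommGroup G] [DecidableEq G] [AddCommGroup L] [Module K L]
  {ε : G → G → Kˣ} {𝓛 : G → Submodule K L} {br : L →ₗ[K] L →ₗ[K] L} {ω : L →ₗ[K] L →ₗ[K] K}

/-- A linear map from `U_ω(L)` to `S(L)` which, up to terms of order less than `n`, sends the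
product of `n` elements of `L` to their product. -/
def PreservesLeadingTerms (Ψ : GenEnv ε 𝓛 br ω →ₗ[K] SymAlg ε 𝓛) : Prop :=
  ∀ n : ℕ, ∀ t ∈ LinearMap.range (TensorAlgebra.ι K (M := L)) ^ n,
    Ψ (envMk ε 𝓛 br ω t) - envMk ε 𝓛 0 0 t ∈ envFiltration ε 𝓛 0 0 (n - 1)

theorem exists_preservesLeadingTerms (h2 : (2 : K) ≠ 0) (h3 : (3 : K) ≠ 0)
    (hε : IsAntisymmBicharacter ε) (hL : IsColorLieAlgebra ε 𝓛 br)
    (hω : IsScalarTwoCocycle ε 𝓛 br ω) :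
    ∃ Ψ : GenEnv ε 𝓛 br ω →ₗ[K] SymAlg ε 𝓛, PreservesLeadingTerms Ψ := by
  classical
  obtain ⟨X, b, d, hb⟩ := exists_isHomogeneousBasis hL.isInternal
  let _ : LinearOrder X := linearOrderOfSTO WellOrderingRel
  let Φ : TensorAlgebra K L →ₗ[K] SymAlg ε 𝓛 := extendWords b
    (straighten b br ω (basisSign ε d) fun w => envMk ε 𝓛 0 0 (word b w))
  have hΦ (n : ℕ) : KillsRelators ε 𝓛 br ω Φ n := killsRelators_of_exists_redexOccurrence
    h2 h3 hε hL hω hb (fun _ => exists_wordDefect_straighten_eq_zero b br ω _ _ h2) n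
  have hirr (w) (hw : IsEmpty (RedexOccurrence (basisSign ε d) w)) :
      Φ (word b w) = envMk ε 𝓛 0 0 (word b w) := by
    rw [extendWords_word, straighten_of_isEmpty _ _ _ _ _ hw]
  obtain ⟨Ψ, hΨ⟩ := exists_comp_envMk_eq hΦ
  refine ⟨Ψ, fun n t ht => ?_⟩
  rw [hΨ]
  rw [range_ι_pow_eq_span b] at ht
  refine Submodule.span_le
    (p := (envFiltration ε 𝓛 0 0 (n - 1)).comap (Φ - (envMk ε 𝓛 0 0).toLinearMap)).2 ?_ ht
  rintro _ ⟨w, rfl, rfl⟩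
  exact map_word_sub_envMk_mem h2 hb hΦ hirr w

end

/-! ### Gradings and projections -/

section TensorGrading

variable {K G L : Type*} [Field K] [AddCommGroup G] [AddCommGroup L] [Module K L]
  {𝓛 : G → Submodule K L}

theorem tensorGrading_le {N : ℤ × G → Submodule K (TensorAlgebra K L)} (h1 : 1 ∈ N 0)
    (hι : ∀ (g : G) (p : ℤ × G) (a : L) (t : TensorAlgebra K L), a ∈ 𝓛 g → t ∈ N p →
      TensorAlgebra.ι K a * t ∈ N ((1, g) + p)) (p : ℤ × G) : tensorGrading 𝓛 p ≤ N p := by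
  refine Submodule.span_le.2 ?_
  rintro _ ⟨n, a, d, ha, rfl, rfl⟩
  induction n with
  | zero => simpa using! h1
  | succ n ih =>
    have := hι (d 0) _ (a 0) _ (ha 0) (ih (fun i => a i.succ) (fun i => d i.succ) fun i => ha _)
    rw [TensorAlgebra.tprod_apply] at this ⊢
    rw [List.ofFn_succ, List.prod_cons, Fin.sum_univ_succ]
    rwa [Prod.mk_add_mk, show (1 : ℤ) + n = (n + 1 : ℕ) by push_cast; ring] at this

theorem one_mem_tensorGrading : 1 ∈ tensorGrading 𝓛 0 :=
  Submodule.subset_span ⟨0, Fin.elim0, Fin.elim0, fun i => i.elim0, by simp, by simp⟩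

theorem ι_mul_mem_tensorGrading {g : G} {p : ℤ × G} {a : L} {t : TensorAlgebra K L}
    (ha : a ∈ 𝓛 g) (ht : t ∈ tensorGrading 𝓛 p) :
    TensorAlgebra.ι K a * t ∈ tensorGrading 𝓛 ((1, g) + p) := by
  refine Submodule.span_le (p := (tensorGrading 𝓛 ((1, g) + p)).comap
    (LinearMap.mulLeft K (TensorAlgebra.ι K a))).2 ?_ ht
  rintro _ ⟨n, c, d, hc, rfl, rfl⟩
  refine Submodule.subset_span ⟨n + 1, Fin.cons a c, Fin.cons g d,
    Fin.cases (by simpa using ha) (by simpa using hc), ?_, ?_⟩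
  · simp [Fin.sum_univ_succ, add_comm]
  · simp [List.ofFn_succ]

theorem ι_mem_tensorGrading {g : G} {a : L} (ha : a ∈ 𝓛 g) :
    TensorAlgebra.ι K a ∈ tensorGrading 𝓛 (1, g) := by
  simpa using ι_mul_mem_tensorGrading ha one_mem_tensorGrading

instance : SetLike.GradedMonoid (tensorGrading 𝓛) where
  one_mem := one_mem_tensorGrading
  mul_mem p q s t hs ht := by
    refine tensorGrading_le
      (N := fun p => (tensorGrading 𝓛 (p + q)).comap (LinearMap.mulRight K t)) ?_ ?_ p hs
    · simpa using ht
    · intro g p a s ha hs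
      simpa [mul_assoc, add_assoc] using ι_mul_mem_tensorGrading ha hs

theorem tensorGrading_le_range_ι_pow (n : ℕ) (g : G) :
    tensorGrading 𝓛 (n, g) ≤ LinearMap.range (TensorAlgebra.ι K (M := L)) ^ n := by
  refine Submodule.span_le.2 ?_
  rintro _ ⟨m, a, d, -, hp, rfl⟩
  obtain rfl : m = n := Int.ofNat_inj.1 (congrArg Prod.fst hp)
  simpa [TensorAlgebra.tprod_apply] using SetLike.list_prod_ofFn_mem_graded
    (A := fun n : ℕ => LinearMap.range (TensorAlgebra.ι K (M := L)) ^ n) (fun _ => 1)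
    (fun i => TensorAlgebra.ι K (a i)) (fun i => by simp)

theorem tensorGrading_eq_bot_of_neg {n : ℤ} (hn : n < 0) (g : G) : tensorGrading 𝓛 (n, g) = ⊥ := by
  refine Submodule.span_eq_bot.2 ?_
  rintro _ ⟨m, a, d, -, hp, -⟩
  have : (m : ℤ) = n := congrArg Prod.fst hp
  lia

theorem tensorGrading_le_tensorFiltration (n : ℤ) (g : G) :
    tensorGrading 𝓛 (n, g) ≤ tensorFiltration K L n := by
  rcases lt_or_ge n 0 with hn | hn
  · exact (tensorGrading_eq_bot_of_neg hn g).trans_le bot_le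
  · lift n to ℕ using hn
    exact (tensorGrading_le_range_ι_pow n g).trans (pow_le_tensorFiltration le_rfl)

variable [DecidableEq G]

theorem range_ι_pow_le_iSup_tensorGrading (h𝓛 : DirectSum.IsInternal 𝓛) (n : ℕ) :
    LinearMap.range (TensorAlgebra.ι K (M := L)) ^ n ≤ ⨆ g, tensorGrading 𝓛 (n, g) := by
  have hι : LinearMap.range (TensorAlgebra.ι K (M := L)) =
      ⨆ g, (𝓛 g).map (TensorAlgebra.ι K) := by
    rw [← Submodule.map_iSup, h𝓛.submodule_iSup_eq_top, LinearMap.range_eq_map]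
  induction n with
  | zero =>
    rw [pow_zero, Submodule.one_le]
    exact Submodule.mem_iSup_of_mem 0 one_mem_tensorGrading
  | succ n ih =>
    rw [pow_succ']
    refine (mul_le_mul' hι.le ih).trans ?_
    simp only [Submodule.iSup_mul, Submodule.mul_iSup]
    refine iSup₂_le fun h g => Submodule.mul_le.2 ?_
    rintro _ ⟨a, ha, rfl⟩ t ht
    refine Submodule.mem_iSup_of_mem (g + h) ?_
    simpa [add_comm (1 : ℤ)] using ι_mul_mem_tensorGrading ha ht

theorem tensorFiltration_le_iSup_tensorGrading (h𝓛 : DirectSum.IsInternal 𝓛) (n : ℤ) :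
    tensorFiltration K L n ≤ ⨆ (p : ℤ × G) (_ : p.1 ≤ n), tensorGrading 𝓛 p :=
  iSup₂_le fun m hm => (range_ι_pow_le_iSup_tensorGrading h𝓛 m).trans <|
    iSup_le fun g => le_iSup₂_of_le (m, g) hm le_rfl

theorem iSup_tensorGrading (h𝓛 : DirectSum.IsInternal 𝓛) : ⨆ p, tensorGrading 𝓛 p = ⊤ := by
  rw [eq_top_iff]
  intro t _
  obtain ⟨n, ht⟩ := exists_mem_tensorFiltration t
  exact (tensorFiltration_le_iSup_tensorGrading h𝓛 n).trans (iSup₂_le_iSup _ _) ht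

end TensorGrading

section Projections

variable {K G L A Γ : Type*} [Field K] [AddCommGroup G] [AddCommGroup L] [Module K L]
  [Ring A] [Algebra K A] [AddCommMonoid Γ]
  {ε : G → G → Kˣ} {𝓛 : G → Submodule K L} {br : L →ₗ[K] L →ₗ[K] L} {ω : L →ₗ[K] L →ₗ[K] K}

variable (ε 𝓛 br ω) in
/-- The defining relations of `U_ω(L)` are homogeneous when `T(L)` is graded by the image of the
`ℤ × G`-degree under `Q`. -/
def HasHomogeneousRelators (Q : ℤ × G →+ Γ) : Prop :=
  ∀ ⦃g h : G⦄ ⦃a c : L⦄, a ∈ 𝓛 g → c ∈ 𝓛 h →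
    ∃ γ, relator br ω (ε g h : K) a c ∈ ⨆ (p) (_ : Q p = γ), tensorGrading 𝓛 p

theorem colorComm_mem_tensorGrading {g h : G} {a c : L} (ha : a ∈ 𝓛 g) (hc : c ∈ 𝓛 h) (k : K) :
    colorComm k (TensorAlgebra.ι K a) (TensorAlgebra.ι K c) ∈ tensorGrading 𝓛 (2, g + h) := by
  have hac := ι_mul_mem_tensorGrading ha (ι_mem_tensorGrading hc)
  have hca := ι_mul_mem_tensorGrading hc (ι_mem_tensorGrading ha)
  rw [Prod.mk_add_mk, one_add_one_eq_two] at hac hca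
  rw [colorComm_apply]
  exact sub_mem hac (Submodule.smul_mem _ _ (add_comm h g ▸ hca))

theorem hasHomogeneousRelators_zero (Q : ℤ × G →+ Γ) : HasHomogeneousRelators ε 𝓛 0 0 Q := by
  intro g h a c ha hc
  refine ⟨Q (2, g + h), Submodule.mem_iSup_of_mem _ (Submodule.mem_iSup_of_mem rfl ?_)⟩
  simpa [relator_apply, lowerTerm_apply] using colorComm_mem_tensorGrading ha hc _

variable [DecidableEq G]

theorem hasHomogeneousRelators_snd (hL : IsColorLieAlgebra ε 𝓛 br)
    (hω : IsScalarTwoCocycle ε 𝓛 br ω) :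
    HasHomogeneousRelators ε 𝓛 br ω (AddMonoidHom.snd ℤ G) := by
  intro g h a c ha hc
  have hle (n : ℤ) : tensorGrading 𝓛 (n, g + h) ≤
      ⨆ (p) (_ : AddMonoidHom.snd ℤ G p = g + h), tensorGrading 𝓛 p :=
    le_iSup₂_of_le (n, g + h) rfl le_rfl
  refine ⟨g + h, ?_⟩
  rw [relator_apply, lowerTerm_apply]
  refine sub_mem (hle 2 (colorComm_mem_tensorGrading ha hc _)) (add_mem
    (hle 1 (ι_mem_tensorGrading (hL.bracket_mem ha hc))) ?_)
  by_cases hgh : g + h = 0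
  · refine hle 0 ?_
    rw [hgh, Algebra.algebraMap_eq_smul_one]
    exact Submodule.smul_mem _ _ one_mem_tensorGrading
  · rw [hω.degree_zero ha hc hgh, map_zero]
    exact zero_mem _

theorem exists_algHom_eq_single (h𝓛 : DirectSum.IsInternal 𝓛) (Q : ℤ × G →+ Γ)
    (f : TensorAlgebra K L →ₐ[K] A) :
    ∃ δ : TensorAlgebra K L →ₐ[K] AddMonoidAlgebra A Γ,
      ∀ p, ∀ t ∈ tensorGrading 𝓛 p, δ t = AddMonoidAlgebra.single (Q p) (f t) := by
  let _ := h𝓛.chooseDecomposition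
  let θ : L →ₗ[K] AddMonoidAlgebra A Γ := DirectSum.toModule K G _ (fun g =>
    AddMonoidAlgebra.lsingle (Q (1, g)) ∘ₗ f.toLinearMap ∘ₗ TensorAlgebra.ι K ∘ₗ (𝓛 g).subtype) ∘ₗ
      (DirectSum.decomposeLinearEquiv 𝓛).toLinearMap
  have hθ {g : G} {a : L} (ha : a ∈ 𝓛 g) :
      θ a = AddMonoidAlgebra.single (Q (1, g)) (f (TensorAlgebra.ι K a)) := by
    simp only [θ, LinearMap.comp_apply, LinearEquiv.coe_coe, DirectSum.decomposeLinearEquiv_apply,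
      DirectSum.decompose_of_mem 𝓛 ha]
    exact DirectSum.toModule_lof K g _
  refine ⟨TensorAlgebra.lift K θ, tensorGrading_le (N := fun p => LinearMap.eqLocus
    (TensorAlgebra.lift K θ).toLinearMap (AddMonoidAlgebra.lsingle (Q p) ∘ₗ f.toLinearMap)) ?_ ?_⟩
  · simp [AddMonoidAlgebra.one_def]
  · intro g p a t ha ht
    simp only [LinearMap.mem_eqLocus, AlgHom.toLinearMap_apply, LinearMap.comp_apply,
      AddMonoidAlgebra.lsingle_apply, map_mul, map_add, TensorAlgebra.lift_ι_apply] at ht ⊢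
    rw [ht, hθ ha, AddMonoidAlgebra.single_mul_single]

theorem exists_coaction (h𝓛 : DirectSum.IsInternal 𝓛) {Q : ℤ × G →+ Γ}
    (hQ : HasHomogeneousRelators ε 𝓛 br ω Q) :
    ∃ δ : GenEnv ε 𝓛 br ω →ₐ[K] AddMonoidAlgebra (GenEnv ε 𝓛 br ω) Γ,
      ∀ p, ∀ t ∈ tensorGrading 𝓛 p,
        δ (envMk ε 𝓛 br ω t) = AddMonoidAlgebra.single (Q p) (envMk ε 𝓛 br ω t) := by
  obtain ⟨δ, hδ⟩ := exists_algHom_eq_single h𝓛 Q (envMk ε 𝓛 br ω)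
  have hδ_weight (γ : Γ) : ⨆ (p) (_ : Q p = γ), tensorGrading 𝓛 p ≤
      LinearMap.eqLocus δ.toLinearMap
        (AddMonoidAlgebra.lsingle γ ∘ₗ (envMk ε 𝓛 br ω).toLinearMap) :=
    iSup₂_le fun p hp t ht => hp ▸ hδ p t ht
  refine ⟨RingQuot.liftAlgHom K ⟨δ, ?_⟩, fun p t ht => ?_⟩
  · rintro _ _ ⟨ha, hc⟩
    obtain ⟨γ, hγ⟩ := hQ ha hc
    rw [map_zero, sub_sub]
    refine (hδ_weight γ hγ).trans ?_
    simp [envMk_relator ha hc]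
  · rw [← hδ p t ht]
    exact RingQuot.liftAlgHom_mkAlgHom_apply K δ _ t

theorem exists_projections [DecidableEq Γ] (h𝓛 : DirectSum.IsInternal 𝓛) {Q : ℤ × G →+ Γ}
    (hQ : HasHomogeneousRelators ε 𝓛 br ω Q) :
    ∃ π : Γ → GenEnv ε 𝓛 br ω →ₗ[K] GenEnv ε 𝓛 br ω, ∀ γ p, ∀ t ∈ tensorGrading 𝓛 p,
      π γ (envMk ε 𝓛 br ω t) = if Q p = γ then envMk ε 𝓛 br ω t else 0 := by
  obtain ⟨δ, hδ⟩ := exists_coaction h𝓛 hQ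
  refine ⟨fun γ => Finsupp.lapply γ ∘ₗ (AddMonoidAlgebra.coeffLinearEquiv K).toLinearMap ∘ₗ
    δ.toLinearMap, fun γ p t ht => ?_⟩
  change (δ (envMk ε 𝓛 br ω t)).coeff γ = _
  rw [hδ p t ht, AddMonoidAlgebra.coeff_single, Finsupp.single_apply]

end Projections

theorem iSupIndep_of_projections {K M ι : Type*} [Semiring K] [AddCommMonoid M] [Module K M]
    {A : ι → Submodule K M} (π : ι → M →ₗ[K] M) (hπ : ∀ i, ∀ x ∈ A i, π i x = x)
    (hπ_ne : ∀ i j, j ≠ i → ∀ x ∈ A j, π i x = 0) : iSupIndep A := by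
  intro i
  rw [Submodule.disjoint_def]
  intro x hx hx'
  rw [← hπ i x hx]
  exact (iSup₂_le (hπ_ne i) : ⨆ (j) (_ : j ≠ i), A j ≤ LinearMap.ker (π i)) hx'

theorem nonempty_gradedAlgebra_of_map {K A B Γ : Type*} [CommRing K] [Ring A] [Algebra K A]
    [Ring B] [Algebra K B] [AddMonoid Γ] [DecidableEq Γ] {𝒜 : Γ → Submodule K A}
    [SetLike.GradedMonoid 𝒜] (h𝒜 : DirectSum.IsInternal 𝒜) {ℬ : Γ → Submodule K B} (φ : A →ₐ[K] B)
    (hφ : Function.Bijective φ) (hmap : ∀ p, (𝒜 p).map φ.toLinearMap = ℬ p) :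
    Nonempty (GradedAlgebra ℬ) := by
  obtain rfl : (fun p => (𝒜 p).map φ.toLinearMap) = ℬ := funext hmap
  have hmonoid : SetLike.GradedMonoid fun p => (𝒜 p).map φ.toLinearMap :=
    { one_mem := ⟨1, SetLike.one_mem_graded 𝒜, map_one φ⟩
      mul_mem := by
        rintro p q _ _ ⟨a, ha, rfl⟩ ⟨b, hb, rfl⟩
        exact ⟨a * b, SetLike.mul_mem_graded ha hb, map_mul φ a b⟩ }
  have hinternal : DirectSum.IsInternal fun p => (𝒜 p).map φ.toLinearMap := by
    refine DirectSum.isInternal_submodule_of_iSupIndep_of_iSup_eq_top ?_ ?_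
    · exact h𝒜.submodule_iSupIndep.map_orderIso
        (Submodule.orderIsoMapComap (LinearEquiv.ofBijective φ.toLinearMap hφ))
    · rw [← Submodule.map_iSup, h𝒜.submodule_iSup_eq_top, Submodule.map_top,
        LinearMap.range_eq_top]
      exact hφ.surjective
  exact ⟨{ hmonoid, hinternal.chooseDecomposition with }⟩

section

variable {K G L : Type*} [Field K] [AddCommGroup G] [AddCommGroup L] [Module K L] [DecidableEq G]
  {ε : G → G → Kˣ} {𝓛 : G → Submodule K L} {br : L →ₗ[K] L →ₗ[K] L} {ω : L →ₗ[K] L →ₗ[K] K}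

theorem isInternal_symGrading (h𝓛 : DirectSum.IsInternal 𝓛) :
    DirectSum.IsInternal (symGrading ε 𝓛) := by
  obtain ⟨π, hπ⟩ := exists_projections (ε := ε) h𝓛
    (hasHomogeneousRelators_zero (AddMonoidHom.id (ℤ × G)))
  refine DirectSum.isInternal_submodule_of_iSupIndep_of_iSup_eq_top
    (iSupIndep_of_projections π ?_ ?_) ?_
  · rintro p _ ⟨t, ht, rfl⟩
    exact (hπ p p t ht).trans (if_pos rfl)
  · rintro p q hqp _ ⟨t, ht, rfl⟩
    exact (hπ p q t ht).trans (if_neg hqp)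
  · unfold symGrading
    rw [← Submodule.map_iSup, iSup_tensorGrading h𝓛, Submodule.map_top, LinearMap.range_eq_top]
    exact envMk_surjective

omit [DecidableEq G] in
instance : SetLike.GradedMonoid (symGrading ε 𝓛) where
  one_mem := ⟨1, one_mem_tensorGrading, map_one (envMk ε 𝓛 0 0)⟩
  mul_mem := by
    rintro p q _ _ ⟨s, hs, rfl⟩ ⟨t, ht, rfl⟩
    exact ⟨s * t, SetLike.mul_mem_graded hs ht, map_mul (envMk ε 𝓛 0 0) s t⟩

theorem exists_tensorGrading_sub_mem (hL : IsColorLieAlgebra ε 𝓛 br)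
    (hω : IsScalarTwoCocycle ε 𝓛 br ω) {n : ℤ} {g : G} {x : GenEnv ε 𝓛 br ω}
    (hx : x ∈ envFiltration ε 𝓛 br ω n) (hg : x ∈ envGrading ε 𝓛 br ω g) :
    ∃ t ∈ tensorGrading 𝓛 (n, g),
      x - envMk ε 𝓛 br ω t ∈ envFiltration ε 𝓛 br ω (n - 1) := by
  obtain ⟨π, hπ⟩ := exists_projections hL.isInternal (hasHomogeneousRelators_snd hL hω)
  have hfix : envGrading ε 𝓛 br ω g ≤ LinearMap.eqLocus (π g) LinearMap.id :=
    Submodule.map_le_iff_le_comap.2 (iSup_le fun m t ht => (hπ g _ t ht).trans (if_pos rfl))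
  have hproj : envFiltration ε 𝓛 br ω n ≤ ((tensorGrading 𝓛 (n, g)).map
      (envMk ε 𝓛 br ω).toLinearMap ⊔ envFiltration ε 𝓛 br ω (n - 1)).comap (π g) := by
    refine Submodule.map_le_iff_le_comap.2
      ((tensorFiltration_le_iSup_tensorGrading hL.isInternal n).trans (iSup₂_le ?_))
    rintro ⟨m, h⟩ (hm : m ≤ n) t ht
    rw [Submodule.mem_comap, Submodule.mem_comap, AlgHom.toLinearMap_apply, hπ g _ t ht]
    split_ifs with hh
    · obtain rfl : h = g := hh
      rcases hm.eq_or_lt with rfl | hlt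
      · exact Submodule.mem_sup_left (Submodule.mem_map_of_mem ht)
      · exact Submodule.mem_sup_right (envFiltration_mono (Int.le_sub_one_of_lt hlt)
          (envMk_mem_envFiltration (tensorGrading_le_tensorFiltration m h ht)))
    · exact zero_mem _
  have hx' := hproj hx
  rw [Submodule.mem_comap, show π g x = x from hfix hg] at hx'
  obtain ⟨_, ⟨t, ht, rfl⟩, y, hy, rfl⟩ := Submodule.mem_sup.1 hx'
  exact ⟨t, ht, by simpa using hy⟩

end

section

variable {K G L : Type*} [Field K] [AddCommGroup L] [Module K L]
  {ε : G → G → Kˣ} {𝓛 : G → Submodule K L} {br : L →ₗ[K] L →ₗ[K] L} {ω : L →ₗ[K] L →ₗ[K] K}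

variable (ε 𝓛 br ω) in
/-- The class in `G_ω(L)`, in degree `n`, of an element of `U_{n,ω}(L)`. -/
def grClass (n : ℤ) : envFiltration ε 𝓛 br ω n →ₗ[K] GrEnv ε 𝓛 br ω :=
  DirectSum.lof K ℤ (FilteredAlg.Gr (envFiltration ε 𝓛 br ω)) n ∘ₗ
    FilteredAlg.symb (envFiltration ε 𝓛 br ω) n

theorem grClass_one :
    grClass ε 𝓛 br ω 0 ⟨1, FilteredAlg.one_mem (envFiltration ε 𝓛 br ω)⟩ = 1 := rfl

theorem grClass_mul {i j n : ℤ} (h : i + j = n) (x : envFiltration ε 𝓛 br ω i)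
    (y : envFiltration ε 𝓛 br ω j) (hxy : (x : GenEnv ε 𝓛 br ω) * y ∈ envFiltration ε 𝓛 br ω n) :
    grClass ε 𝓛 br ω i x * grClass ε 𝓛 br ω j y = grClass ε 𝓛 br ω n ⟨x * y, hxy⟩ := by
  subst h
  exact DirectSum.of_mul_of _ _

theorem grClass_eq {n : ℤ} {x y : envFiltration ε 𝓛 br ω n}
    (h : (x : GenEnv ε 𝓛 br ω) - y ∈ envFiltration ε 𝓛 br ω (n - 1)) :
    grClass ε 𝓛 br ω n x = grClass ε 𝓛 br ω n y :=
  congrArg (DirectSum.lof K ℤ (FilteredAlg.Gr (envFiltration ε 𝓛 br ω)) n)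
    (FilteredAlg.symb_eq_symb_iff.2 h)

variable [AddCommGroup G]

theorem canonicalHom_envMk_of_mem_range_ι_pow {n : ℕ} {t : TensorAlgebra K L}
    (ht : t ∈ LinearMap.range (TensorAlgebra.ι K (M := L)) ^ n) :
    canonicalHom ε 𝓛 br ω (envMk ε 𝓛 0 0 t) = grClass ε 𝓛 br ω n
      ⟨envMk ε 𝓛 br ω t, envMk_mem_envFiltration (pow_le_tensorFiltration le_rfl ht)⟩ := by
  induction ht using Submodule.pow_induction_on_left' with
  | algebraMap r =>
    rw [AlgHom.commutes, AlgHom.commutes, Algebra.algebraMap_eq_smul_one,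
      ← grClass_one, ← map_smul]
    congr 1
    exact Subtype.ext (((envMk ε 𝓛 br ω).commutes r).trans (Algebra.algebraMap_eq_smul_one r)).symm
  | add s t n hs ht ihs iht =>
    rw [map_add, map_add, ihs, iht, ← map_add]
    congr 1
    exact Subtype.ext (map_add _ _ _).symm
  | mem_mul a ha n t ht ih =>
    obtain ⟨a, rfl⟩ := ha
    have hmul : envι ε 𝓛 br ω a * envMk ε 𝓛 br ω t = envMk ε 𝓛 br ω (TensorAlgebra.ι K a * t) :=
      (map_mul (envMk ε 𝓛 br ω) _ _).symm
    have hmem : envι ε 𝓛 br ω a * envMk ε 𝓛 br ω t ∈ envFiltration ε 𝓛 br ω n.succ := by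
      rw [hmul]
      exact envMk_mem_envFiltration (pow_le_tensorFiltration le_rfl
        (pow_succ' (LinearMap.range (TensorAlgebra.ι K (M := L))) n ▸
          Submodule.mul_mem_mul (LinearMap.mem_range_self _ a) ht))
    rw [map_mul, map_mul, ih]
    refine (congrArg (· * _) (canonicalHom_ι ε 𝓛 br ω a)).trans ?_
    refine (grClass_mul (by push_cast; ring) ⟨_, envι_mem ε 𝓛 br ω a⟩ _ hmem).trans ?_
    exact congrArg _ (Subtype.ext hmul)

theorem algHom_eq_canonicalHom_iff (ψ : SymAlg ε 𝓛 →ₐ[K] GrEnv ε 𝓛 br ω) :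
    (∀ a : L, ψ (envι ε 𝓛 0 0 a) = grι ε 𝓛 br ω a) ↔ ψ = canonicalHom ε 𝓛 br ω := by
  constructor
  · intro h
    refine RingQuot.ringQuot_ext' K _ _ (TensorAlgebra.hom_ext (LinearMap.ext fun a => ?_))
    exact (h a).trans (canonicalHom_ι ε 𝓛 br ω a).symm
  · rintro rfl a
    exact canonicalHom_ι ε 𝓛 br ω a

theorem canonicalHom_surjective : Function.Surjective (canonicalHom ε 𝓛 br ω) := by
  rw [← AlgHom.range_eq_top, eq_top_iff]
  rintro y -
  induction y using DirectSum.induction_on with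
  | zero => exact zero_mem _
  | add y z hy hz => exact add_mem hy hz
  | of n y =>
    obtain ⟨⟨_, t, ht, rfl⟩, rfl⟩ := FilteredAlg.symb_surjective n y
    rcases lt_or_ge n 0 with hn | hn
    · obtain rfl : t = 0 := by simpa [tensorFiltration_eq_bot_of_neg hn] using ht
      refine ⟨0, (map_zero (canonicalHom ε 𝓛 br ω)).trans ?_⟩
      exact (map_zero (grClass ε 𝓛 br ω n)).symm.trans (grClass_eq (by simp))
    · lift n to ℕ using hn
      obtain ⟨s, hs, hst⟩ := exists_range_ι_pow_sub_mem ht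
      refine ⟨envMk ε 𝓛 0 0 s, (canonicalHom_envMk_of_mem_range_ι_pow hs).trans (grClass_eq ?_)⟩
      exact map_sub (envMk ε 𝓛 br ω) s t ▸ envMk_mem_envFiltration hst

theorem canonicalHom_envMk_of_mem_tensorGrading {n : ℤ} {g : G} {t : TensorAlgebra K L}
    (ht : t ∈ tensorGrading 𝓛 (n, g)) :
    canonicalHom ε 𝓛 br ω (envMk ε 𝓛 0 0 t) = grClass ε 𝓛 br ω n
      ⟨envMk ε 𝓛 br ω t, envMk_mem_envFiltration (tensorGrading_le_tensorFiltration n g ht)⟩ := by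
  rcases lt_or_ge n 0 with hn | hn
  · obtain rfl : t = 0 := by simpa [tensorGrading_eq_bot_of_neg hn] using ht
    simp only [map_zero]
    exact (map_zero _).symm
  · lift n to ℕ using hn
    exact canonicalHom_envMk_of_mem_range_ι_pow (tensorGrading_le_range_ι_pow n g ht)

variable [DecidableEq G]

theorem map_symGrading_canonicalHom (hL : IsColorLieAlgebra ε 𝓛 br)
    (hω : IsScalarTwoCocycle ε 𝓛 br ω) (p : ℤ × G) :
    (symGrading ε 𝓛 p).map (canonicalHom ε 𝓛 br ω).toLinearMap = grGrading ε 𝓛 br ω p := by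
  obtain ⟨n, g⟩ := p
  refine le_antisymm ?_ ?_
  · rintro _ ⟨_, ⟨t, ht, rfl⟩, rfl⟩
    exact ⟨_, ⟨_, ⟨t, Submodule.mem_iSup_of_mem n ht, rfl⟩, rfl⟩,
      (canonicalHom_envMk_of_mem_tensorGrading ht).symm⟩
  · rintro _ ⟨_, ⟨⟨x, hx⟩, hg, rfl⟩, rfl⟩
    obtain ⟨t, ht, hxt⟩ := exists_tensorGrading_sub_mem hL hω hx hg
    exact ⟨_, ⟨t, ht, rfl⟩, (canonicalHom_envMk_of_mem_tensorGrading ht).trans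
      (grClass_eq (x := ⟨x, hx⟩) hxt).symm⟩

end

/-! ### The canonical homomorphism -/

section

variable {K G L : Type*} [Field K] [AddCommGroup L] [Module K L]
  {ε : G → G → Kˣ} {𝓛 : G → Submodule K L} {br : L →ₗ[K] L →ₗ[K] L} {ω : L →ₗ[K] L →ₗ[K] K}

theorem PreservesLeadingTerms.map_mem_envFiltration {Ψ : GenEnv ε 𝓛 br ω →ₗ[K] SymAlg ε 𝓛}
    (hΨ : PreservesLeadingTerms Ψ) {n : ℤ} {x : GenEnv ε 𝓛 br ω}
    (hx : x ∈ envFiltration ε 𝓛 br ω n) : Ψ x ∈ envFiltration ε 𝓛 0 0 n := by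
  obtain ⟨t, ht, rfl⟩ := hx
  refine (iSup₂_le fun m hm s hs => ?_ : tensorFiltration K L n ≤
    (envFiltration ε 𝓛 0 0 n).comap (Ψ ∘ₗ (envMk ε 𝓛 br ω).toLinearMap)) ht
  exact (Submodule.sub_mem_iff_left _ (envMk_mem_envFiltration (pow_le_tensorFiltration hm hs))).1
    (envFiltration_mono (by lia) (hΨ m s hs))

theorem exists_map_grClass_eq {M : Type*} [AddCommGroup M] [Module K M]
    (f : ℤ → GenEnv ε 𝓛 br ω →ₗ[K] M)
    (hf : ∀ n, ∀ x ∈ envFiltration ε 𝓛 br ω (n - 1), f n x = 0) :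
    ∃ Λ : GrEnv ε 𝓛 br ω →ₗ[K] M, ∀ n x, Λ (grClass ε 𝓛 br ω n x) = f n x :=
  ⟨DirectSum.toModule K ℤ M fun n => Submodule.liftQ
    ((envFiltration ε 𝓛 br ω (n - 1)).submoduleOf (envFiltration ε 𝓛 br ω n))
    (f n ∘ₗ (envFiltration ε 𝓛 br ω n).subtype) fun x hx => hf n x hx,
  fun _ _ => DirectSum.toModule_lof K _ _⟩

variable [AddCommGroup G] [DecidableEq G]

theorem exists_order_projections (h𝓛 : DirectSum.IsInternal 𝓛) :
    ∃ π : ℤ → SymAlg ε 𝓛 →ₗ[K] SymAlg ε 𝓛,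
      (∀ n, ∀ x ∈ envFiltration ε 𝓛 0 0 (n - 1), π n x = 0) ∧
      ∀ n : ℕ, ∀ t ∈ LinearMap.range (TensorAlgebra.ι K (M := L)) ^ n,
        π n (envMk ε 𝓛 0 0 t) = envMk ε 𝓛 0 0 t := by
  obtain ⟨π, hπ⟩ := exists_projections (ε := ε) h𝓛
    (hasHomogeneousRelators_zero (AddMonoidHom.fst ℤ G))
  refine ⟨π, ?_, fun n t ht => ?_⟩
  · rintro n _ ⟨t, ht, rfl⟩
    refine (iSup₂_le fun p (hp : p.1 ≤ n - 1) s hs => (hπ n p s hs).trans (if_neg ?_) :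
      ⨆ (p : ℤ × G) (_ : p.1 ≤ n - 1), tensorGrading 𝓛 p ≤
        LinearMap.ker (π n ∘ₗ (envMk ε 𝓛 0 0).toLinearMap))
      (tensorFiltration_le_iSup_tensorGrading h𝓛 _ ht)
    exact (hp.trans_lt (sub_one_lt n)).ne
  · exact (iSup_le fun g s hs => (hπ n (n, g) s hs).trans (if_pos rfl) :
      ⨆ g, tensorGrading 𝓛 (n, g) ≤ LinearMap.eqLocus
        (π n ∘ₗ (envMk ε 𝓛 0 0).toLinearMap) (envMk ε 𝓛 0 0).toLinearMap)
      (range_ι_pow_le_iSup_tensorGrading h𝓛 n ht)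

theorem PreservesLeadingTerms.canonicalHom_injective {Ψ : GenEnv ε 𝓛 br ω →ₗ[K] SymAlg ε 𝓛}
    (hΨ : PreservesLeadingTerms Ψ) (h𝓛 : DirectSum.IsInternal 𝓛) :
    Function.Injective (canonicalHom ε 𝓛 br ω) := by
  obtain ⟨π, hπ_lower, hπ_top⟩ := exists_order_projections (ε := ε) h𝓛
  obtain ⟨Λ, hΛ⟩ := exists_map_grClass_eq (fun n => π n ∘ₗ Ψ) fun n x hx =>
    hπ_lower n _ (hΨ.map_mem_envFiltration hx)
  have hpow (n : ℕ) (t) (ht : t ∈ LinearMap.range (TensorAlgebra.ι K (M := L)) ^ n) :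
      Λ (canonicalHom ε 𝓛 br ω (envMk ε 𝓛 0 0 t)) = envMk ε 𝓛 0 0 t := by
    have hsub := hπ_lower n _ (hΨ n t ht)
    rw [map_sub, hπ_top n t ht, sub_eq_zero] at hsub
    rwa [canonicalHom_envMk_of_mem_range_ι_pow ht, hΛ]
  refine Function.LeftInverse.injective (g := Λ) fun x => ?_
  obtain ⟨t, rfl⟩ := envMk_surjective x
  obtain ⟨n, ht⟩ := exists_mem_tensorFiltration t
  exact (iSup₂_le fun m _ => hpow m : tensorFiltration K L n ≤ LinearMap.eqLocus
    (Λ ∘ₗ ((canonicalHom ε 𝓛 br ω).comp (envMk ε 𝓛 0 0)).toLinearMap)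
    (envMk ε 𝓛 0 0).toLinearMap) ht

end

end ColorLie

end

theorem proposition2p3_general {K G L : Type*} [Field K] [AddCommGroup G] [DecidableEq G]
    [AddCommGroup L] [Module K L] (h2 : (2 : K) ≠ 0) (h3 : (3 : K) ≠ 0)
    (ε : G → G → Kˣ) (hε : ColorLie.IsAntisymmBicharacter ε)
    (𝓛 : G → Submodule K L) (br : L →ₗ[K] L →ₗ[K] L)
    (hL : ColorLie.IsColorLieAlgebra ε 𝓛 br)
    (ω : L →ₗ[K] L →ₗ[K] K) (hω : ColorLie.IsScalarTwoCocycle ε 𝓛 br ω) :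
    Nonempty (GradedAlgebra (ColorLie.symGrading ε 𝓛)) ∧
    Nonempty (GradedAlgebra (ColorLie.grGrading ε 𝓛 br ω)) ∧
    (∀ ψ : ColorLie.SymAlg ε 𝓛 →ₐ[K] ColorLie.GrEnv ε 𝓛 br ω,
      (∀ a : L, ψ (ColorLie.envι ε 𝓛 0 0 a) = ColorLie.grι ε 𝓛 br ω a) ↔
        ψ = ColorLie.canonicalHom ε 𝓛 br ω) ∧
    (∀ p : ℤ × G, (ColorLie.symGrading ε 𝓛 p).map (ColorLie.canonicalHom ε 𝓛 br ω).toLinearMap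
      = ColorLie.grGrading ε 𝓛 br ω p) ∧
    Function.Bijective (ColorLie.canonicalHom ε 𝓛 br ω) := by
  obtain ⟨Ψ, hΨ⟩ := ColorLie.exists_preservesLeadingTerms h2 h3 hε hL hω
  have hmap := ColorLie.map_symGrading_canonicalHom hL hω
  have hbij : Function.Bijective (ColorLie.canonicalHom ε 𝓛 br ω) :=
    ⟨hΨ.canonicalHom_injective hL.isInternal, ColorLie.canonicalHom_surjective⟩
  have hsym := ColorLie.isInternal_symGrading (ε := ε) hL.isInternal
  exact ⟨⟨{ hsym.chooseDecomposition with }⟩,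
    ColorLie.nonempty_gradedAlgebra_of_map hsym _ hbij hmap,
    ColorLie.algHom_eq_canonicalHom_iff, hmap, hbij⟩

theorem proposition2p3 {K G L : Type*} [Field K] [CharZero K] [AddCommGroup G] [DecidableEq G]
    [AddCommGroup L] [Module K L]
    (ε : G → G → Kˣ) (hε : ColorLie.IsAntisymmBicharacter ε)
    (𝓛 : G → Submodule K L) (br : L →ₗ[K] L →ₗ[K] L)
    (hL : ColorLie.IsColorLieAlgebra ε 𝓛 br)
    (ω : L →ₗ[K] L →ₗ[K] K) (hω : ColorLie.IsScalarTwoCocycle ε 𝓛 br ω) :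
    Nonempty (GradedAlgebra (ColorLie.symGrading ε 𝓛)) ∧
    Nonempty (GradedAlgebra (ColorLie.grGrading ε 𝓛 br ω)) ∧
    (∀ ψ : ColorLie.SymAlg ε 𝓛 →ₐ[K] ColorLie.GrEnv ε 𝓛 br ω,
      (∀ a : L, ψ (ColorLie.envι ε 𝓛 0 0 a) = ColorLie.grι ε 𝓛 br ω a) ↔
        ψ = ColorLie.canonicalHom ε 𝓛 br ω) ∧
    (∀ p : ℤ × G, (ColorLie.symGrading ε 𝓛 p).map (ColorLie.canonicalHom ε 𝓛 br ω).toLinearMap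
      = ColorLie.grGrading ε 𝓛 br ω p) ∧
    Function.Bijective (ColorLie.canonicalHom ε 𝓛 br ω) :=
  proposition2p3_general two_ne_zero three_ne_zero ε hε 𝓛 br hL ω hω
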